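/- Let $N\ge 1$ be an integer and consider the circular symplectic ensemble (CSE) of $N$ points $\zeta_1,\dots,\zeta_N$ on the unit circle, with joint density $$\frac1{Z_N}\prod_{1\le j<k\le N}|\zeta_j-\zeta_k|^{4}$$ with respect to $\prod_{j}\frac{d\zeta_j}{2\pi i\zeta_j}$, where $Z_N$ is the normalisation; write $\langle\,\cdot\,\rangle$ for the corresponding average. For $z\in\mathbb{C}$ with $|z|\ne1$ put $A(z)=\sum_{j=1}^N\frac{\zeta_j+z}{\zeta_j-z}$, and let $$W_2(z_1,z_2)=\langle A(z_1)A(z_2)\rangle-\langle A(z_1)\rangle\langle A(z_2)\rangle$$ be the second (connected) resolvent function. Let $z_1,z_2$ lie in the $(0,\infty)$ domain, i.e. $|z_1|<1<|z_2|$, and put $\zeta=z_1/z_2$, so that $|\zeta|<1$. (a) $W_2(z_1,z_2)$ depends only on $\zeta$ and $N$, and, writing $W_2(\zeta)$ for it, one has for all $N\ge1$ $$\begin{aligned} W_2(\zeta)={}&2(1-\zeta)^{-1}(1-\zeta^{2N-1})\\ &+(1-\zeta)^{-2}\Big[\zeta^2(1-\zeta^{2N-2})-2(1-\zeta^{2N-1})-\tfrac{2}{2N-1}\zeta(1-\zeta^{2N-1})\Big]\\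 &-\Big[2\zeta(1-\zeta)^{-2}+(2N+1)(1-\zeta)^{-1}\Big]\\ &\quad\times\Big[\tfrac{\zeta^2}{2N-3}\,{}_2F_1(1,\tfrac32-N;\tfrac52-N;\zeta)+\tfrac{\zeta^{2N}}{2N-1}\,{}_2F_1(1,N-\tfrac12;N+\tfrac12;\zeta)\Big], \end{aligned}$$ where ${}_2F_1$ is the Gauss hypergeometric function. (b) In the global regime, as $N\to\infty$, $$W_2(\zeta)=-\frac{2\zeta}{(\zeta-1)^2}+\sum_{r=1}^{9}\frac{(-1)^{r-1}}{2^{r-1}N^r(\zeta-1)^{r+2}}\,\zeta\,p_r(\zeta)+O(N^{-10}),$$ uniformly in $|\zeta|\le\rho$ for every fixed $\rho<1$, where $$\begin{aligned} p_1&=1+\zeta,\\ p_2&=1+4\zeta+\zeta^2,\\ p_3&=1+15\zeta+15\zeta^2+\zeta^3,\\ p_4&=1+50\zeta+138\zeta^2+50\zeta^3+\zeta^4,\\ p_5&=1+157\zeta+994\zeta^2+994\zeta^3+157\zeta^4+\zeta^5,\\ p_6&=1+480\zeta+6231\zeta^2+13456\zeta^3+6231\zeta^4+480\zeta^5+\zeta^6,\\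 p_7&=1+1451\zeta+35961\zeta^2+146907\zeta^3+146907\zeta^4+35961\zeta^5+1451\zeta^6+\zeta^7,\\ p_8&=1+4366\zeta+197224\zeta^2+1402834\zeta^3+2597230\zeta^4+1402834\zeta^5+197224\zeta^6+4366\zeta^7+\zeta^8,\\ p_9&=1+13113\zeta+1047252\zeta^2+12262436\zeta^3+38286798\zeta^4+38286798\zeta^5+12262436\zeta^6+1047252\zeta^7+13113\zeta^8+\zeta^9. \end{aligned}$$ -/

import Mathlib

open MeasureTheory

noncomputable section

namespace CircularEnsemble

/-- A configuration of `N` particles on the unit circle, by their angles in units of `2π`: the `j`-th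
particle sits at `exp (2 π i t j)`, with `t j ∈ ℝ / ℤ`. -/
abbrev Config (N : ℕ) : Type := Fin N → UnitAddCircle

/-- The reference measure `∏ⱼ dζⱼ / (2 π i ζⱼ) = ∏ⱼ dθⱼ / (2 π)`, i.e. the product of the normalised
arc length (Haar probability) measures of the `N` circles. -/
def refMeasure (N : ℕ) : Measure (Config N) :=
  Measure.pi fun _ : Fin N => (AddCircle.haarAddCircle : Measure UnitAddCircle)

/-- The position `ζⱼ = exp (2 π i t j)` of the `j`-th particle in the complex plane. -/
def pos {N : ℕ} (t : Config N) (j : Fin N) : ℂ := (AddCircle.toCircle (t j) : ℂ)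

/-- The unnormalised density `∏_{j < k} |ζⱼ - ζₖ| ^ (2 κ)` of the Dyson circular ensemble with
inverse temperature `β = 2 κ` and no external potential. -/
def density (N : ℕ) (κ : ℝ) (t : Config N) : ℝ :=
  ∏ j : Fin N, ∏ k ∈ Finset.Ioi j, ‖pos t j - pos t k‖ ^ (2 * κ)

/-- The normalisation `Z_N`. -/
def partitionFunction (N : ℕ) (κ : ℝ) : ℝ :=
  ∫ t, density N κ t ∂(refMeasure N)

/-- The ensemble average `⟨f⟩`, with `⟨1⟩ = 1`. -/
def average (N : ℕ) (κ : ℝ) (f : Config N → ℂ) : ℂ :=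
  (∫ t, f t * (density N κ t : ℂ) ∂(refMeasure N)) / (partitionFunction N κ : ℂ)

/-- The linear statistic `∑ⱼ (ζⱼ + z) / (ζⱼ - z)` of the Riesz-Herglotz kernel. -/
def herglotzSum {N : ℕ} (z : ℂ) (t : Config N) : ℂ :=
  ∑ j : Fin N, (pos t j + z) / (pos t j - z)

/-- The second connected resolvent function `W₂(z₁, z₂)`: the second joint cumulant
`⟨A B⟩ - ⟨A⟩ ⟨B⟩` of the Riesz-Herglotz statistics at `z₁` and at `z₂`. -/
def W₂ (N : ℕ) (κ : ℝ) (z₁ z₂ : ℂ) : ℂ :=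
  average N κ (fun t => herglotzSum z₁ t * herglotzSum z₂ t)
    - average N κ (herglotzSum z₁) * average N κ (herglotzSum z₂)

/-- The closed form, as a function of `ζ`, with Gauss hypergeometric functions `₂F₁`. -/
def cseClosedForm (N : ℕ) (ζ : ℂ) : ℂ :=
  2 * (1 - ζ)⁻¹ * (1 - ζ ^ (2 * N - 1))
    + ((1 - ζ) ^ 2)⁻¹ *
      (ζ ^ 2 * (1 - ζ ^ (2 * N - 2)) - 2 * (1 - ζ ^ (2 * N - 1))
        - 2 / (2 * (N : ℂ) - 1) * ζ * (1 - ζ ^ (2 * N - 1)))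
    - (2 * ζ * ((1 - ζ) ^ 2)⁻¹ + (2 * (N : ℂ) + 1) * (1 - ζ)⁻¹) *
      (ζ ^ 2 / (2 * (N : ℂ) - 3) * ₂F₁ (1 : ℂ) (3 / 2 - (N : ℂ)) (5 / 2 - (N : ℂ)) ζ
        + ζ ^ (2 * N) / (2 * (N : ℂ) - 1) * ₂F₁ (1 : ℂ) ((N : ℂ) - 1 / 2) ((N : ℂ) + 1 / 2) ζ)

/-- The large `N` expansion in the global regime, through order `N ^ (-9)`. -/
def cseGlobalExpansion (N : ℕ) (ζ : ℂ) : ℂ :=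
  - (2 * ζ) / (ζ - 1) ^ 2
  + 1 / (N * (ζ - 1) ^ 3) * ζ * (1 + ζ)
  - 1 / (2 * N ^ 2 * (ζ - 1) ^ 4) * ζ * (1 + 4 * ζ + ζ ^ 2)
  + 1 / (4 * N ^ 3 * (ζ - 1) ^ 5) * ζ * (1 + 15 * ζ + 15 * ζ ^ 2 + ζ ^ 3)
  - 1 / (8 * N ^ 4 * (ζ - 1) ^ 6) * ζ * (1 + 50 * ζ + 138 * ζ ^ 2 + 50 * ζ ^ 3 + ζ ^ 4)
  + 1 / (16 * N ^ 5 * (ζ - 1) ^ 7) * ζ *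
      (1 + 157 * ζ + 994 * ζ ^ 2 + 994 * ζ ^ 3 + 157 * ζ ^ 4 + ζ ^ 5)
  - 1 / (32 * N ^ 6 * (ζ - 1) ^ 8) * ζ *
      (1 + 480 * ζ + 6231 * ζ ^ 2 + 13456 * ζ ^ 3 + 6231 * ζ ^ 4 + 480 * ζ ^ 5 + ζ ^ 6)
  + 1 / (64 * N ^ 7 * (ζ - 1) ^ 9) * ζ *
      (1 + 1451 * ζ + 35961 * ζ ^ 2 + 146907 * ζ ^ 3 + 146907 * ζ ^ 4
        + 35961 * ζ ^ 5 + 1451 * ζ ^ 6 + ζ ^ 7)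
  - 1 / (128 * N ^ 8 * (ζ - 1) ^ 10) * ζ *
      (1 + 4366 * ζ + 197224 * ζ ^ 2 + 1402834 * ζ ^ 3 + 2597230 * ζ ^ 4
        + 1402834 * ζ ^ 5 + 197224 * ζ ^ 6 + 4366 * ζ ^ 7 + ζ ^ 8)
  + 1 / (256 * N ^ 9 * (ζ - 1) ^ 11) * ζ *
      (1 + 13113 * ζ + 1047252 * ζ ^ 2 + 12262436 * ζ ^ 3 + 38286798 * ζ ^ 4
        + 38286798 * ζ ^ 5 + 12262436 * ζ ^ 6 + 1047252 * ζ ^ 7 + 13113 * ζ ^ 8 + ζ ^ 9)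

end CircularEnsemble

end

/-! Everything follows from the structure factor S(k) = ⟨|p_k|²⟩ of the power sums p_k = ∑ ζ_j^k.
Expanding both Herglotz kernels in power series, the only surviving moments are those of p_{-k} p_k,
and W₂ = -4 ∑_{k≥1} S(k) ζ^k (`hasSum_W₂`).

S(k) is computed from the Leibniz expansion of a determinant. On the unit circle ∏|ζ_j - ζ_k|⁴ is,
up to a constant and a monomial, a confluent Vandermonde determinant of size 2N
(`det_confluentMatrix`). Each particle owns a pair of slots, and a permutation distributes the
centred odd frequencies -(2N-1), …, 2N-1 over the slots. A Fourier coefficient of the density is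
then a signed, weighted sum over the distributions with prescribed pair totals. Since the
frequencies are distinct, nonzero and closed under negation, a distribution with totals -k, k on two
pairs and 0 elsewhere is one transposition away from a balanced one, with an explicit ratio of
weights (`pairSum_two`). Averaging over flips inside the pairs makes the summed ratio independent of
the distribution (`sum_pairSum_two`). The normalisation divides out, and S(k) = (k/2)(1 + ∑_{e<k}
1/(2N-1-2e)) for 1 ≤ k ≤ 2N, while S(k) = N beyond (`sum_pairRatio`).

For the closed form, summation by parts reduces the generating function to the polynomial ∑_{e<2N}
ζ^e/(2N-1-2e), and the two hypergeometric series are tails of one series whose infinite parts cancel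
(`hypergeometric_combination`).

For the expansion, 1/(2N-1-2e) is a geometric series in (2e+1)/(2N) cut after nine terms. The
coefficients become sums of odd powers, polynomial in k, whose generating functions are combinations
of ∑ k^m ζ^k. The error in S(k) is at most 3k¹²/N¹⁰ for every k
(`norm_structureFactor_sub_expansionCoeff_le`), and ∑ k¹² r^k converges. -/

noncomputable section

namespace CircularEnsemble

/-! ### Signed sums over distributions of frequencies on pairs of slots. -/

section Pairings

open Equiv

variable {ι : Type*}

/-- The total frequency of the `i`-th pair of slots. -/
def pairFreq (d : ι ⊕ ι → ℤ) (σ : Perm (ι ⊕ ι)) (i : ι) : ℤ :=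
  d (σ (Sum.inl i)) + d (σ (Sum.inr i))

/-- In an assignment with frequencies `-k` and `k` on two pairs and `0` on all others, the opposite
of a frequency on the first pair sits on the second pair. -/
lemma exists_opposite {d : ι ⊕ ι → ℤ} (hd : Function.Injective d) {ν : ι ⊕ ι → ι ⊕ ι}
    (hν : ∀ s, d (ν s) = - d s) (h0 : ∀ s, d s ≠ 0) {j l : ι} {k : ℤ} (hk : k ≠ 0)
    {σ : Perm (ι ⊕ ι)} (hj : pairFreq d σ j = -k)
    (h3 : ∀ i, i ≠ j → i ≠ l → pairFreq d σ i = 0) :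
    d (σ (Sum.inl l)) = - d (σ (Sum.inl j)) ∨ d (σ (Sum.inr l)) = - d (σ (Sum.inl j)) := by
  have hs : d (σ (σ.symm (ν (σ (Sum.inl j))))) = - d (σ (Sum.inl j)) := by
    rw [Equiv.apply_symm_apply, hν]
  have hinj : ∀ s t, d (σ s) = d (σ t) → s = t := fun s t h => σ.injective (hd h)
  have hz := h0 (σ (Sum.inl j))
  unfold pairFreq at hj h3
  generalize σ.symm (ν (σ (Sum.inl j))) = s at hs
  rcases s with i | i
  -- On a third pair, balance would give the other slot the frequency of `σ (Sum.inl j)` a second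
  -- time. On pair `j` itself, either that frequency or `k` would be zero.
  · by_cases hil : i = l
    · subst hil; exact Or.inl hs
    · by_cases hij : i = j
      · subst hij; omega
      · have := hinj (Sum.inr i) (Sum.inl j) (by have := h3 i hij hil; omega)
        simp at this
  · by_cases hil : i = l
    · subst hil; exact Or.inr hs
    · by_cases hij : i = j
      · subst hij; omega
      · have := hinj (Sum.inl i) (Sum.inl j) (by have := h3 i hij hil; omega)
        exact absurd (Sum.inl_injective this) hij

variable [DecidableEq ι]

/-- Interchanging the two slots of one pair. -/
def flip (i : ι) : Perm (ι ⊕ ι) := swap (Sum.inl i) (Sum.inr i)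

lemma pairFreq_mul_flip (d : ι ⊕ ι → ℤ) (σ : Perm (ι ⊕ ι)) (j i : ι) :
    pairFreq d (σ * flip j) i = pairFreq d σ i := by
  by_cases h : i = j
  · subst h; simp [pairFreq, flip, add_comm]
  · simp [pairFreq, flip, swap_apply_def, h]

lemma pairFreq_update (d : ι ⊕ ι → ℤ) {j l : ι} (hjl : j ≠ l) {k : ℤ} (σ : Perm (ι ⊕ ι)) :
    (∀ i, pairFreq d σ i = (Pi.single j (-k) + Pi.single l k : ι → ℤ) i) ↔
      pairFreq d σ j = -k ∧ pairFreq d σ l = k ∧ ∀ i, i ≠ j → i ≠ l → pairFreq d σ i = 0 := by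
  constructor
  · intro h
    refine ⟨by simpa [hjl] using h j, by simpa [hjl.symm] using h l, fun i hj hl => ?_⟩
    simpa [hj, hl] using h i
  · rintro ⟨h1, h2, h3⟩ i
    by_cases hj : i = j
    · subst hj; simp [hjl, h1]
    by_cases hl : i = l
    · subst hl; simp [hjl.symm, h2]
    simp [hj, hl, h3 i hj hl]

variable [Fintype ι]

/-- The term of the confluent determinant that belongs to an assignment `σ` of frequencies to the
pairs of slots `(inl i, inr i)`. -/
def pairWeight (d : ι ⊕ ι → ℤ) (σ : Perm (ι ⊕ ι)) : ℂ :=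
  ((Perm.sign σ : ℤ) : ℂ) * ∏ i, (d (σ (Sum.inr i)) : ℂ)

open Classical in
/-- The sum of the weights of all assignments with prescribed total frequencies. -/
def pairSum (d : ι ⊕ ι → ℤ) (c : ι → ℤ) : ℂ :=
  ∑ σ : Perm (ι ⊕ ι), if (∀ i, pairFreq d σ i = c i) then pairWeight d σ else 0

/-- The flip changes the sign of the permutation, and in a balanced pair it also changes the sign of
the factor, so the two signs cancel. This is the reason for centring the frequencies. -/
lemma pairWeight_mul_flip (d : ι ⊕ ι → ℤ) (σ : Perm (ι ⊕ ι)) (j : ι)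
    (h : pairFreq d σ j = 0) : pairWeight d (σ * flip j) = pairWeight d σ := by
  have h1 : d (σ (Sum.inl j)) = - d (σ (Sum.inr j)) := by
    unfold pairFreq at h; omega
  unfold pairWeight
  rw [← Finset.mul_prod_erase _ _ (Finset.mem_univ j),
    ← Finset.mul_prod_erase Finset.univ (fun i => (d (σ (Sum.inr i)) : ℂ)) (Finset.mem_univ j)]
  have h2 : ∏ i ∈ Finset.univ.erase j, (d ((σ * flip j) (Sum.inr i)) : ℂ)
      = ∏ i ∈ Finset.univ.erase j, (d (σ (Sum.inr i)) : ℂ) := by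
    refine Finset.prod_congr rfl fun i hi => ?_
    have : i ≠ j := Finset.ne_of_mem_erase hi
    simp [flip, swap_apply_def, this]
  rw [h2]
  simp [flip, h1]

open Classical in
/-- A sum over balanced assignments does not change when one pair is flipped. -/
lemma sum_balanced_flip (d : ι ⊕ ι → ℤ) (j : ι) (g : Perm (ι ⊕ ι) → ℂ) :
    ∑ σ : Perm (ι ⊕ ι), (if (∀ i, pairFreq d σ i = 0) then pairWeight d σ * g σ else 0)
      = ∑ σ : Perm (ι ⊕ ι),
          (if (∀ i, pairFreq d σ i = 0) then pairWeight d σ * g (σ * flip j) else 0) := by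
  rw [← Equiv.sum_comp (Equiv.mulRight (flip j))]
  refine Finset.sum_congr rfl fun σ _ => ?_
  simp only [Equiv.coe_mulRight, pairFreq_mul_flip]
  split_ifs with h
  · rw [pairWeight_mul_flip d σ j (h j)]
  · rfl

lemma prod_split_two {j l : ι} (hjl : j ≠ l) (f : ι → ℂ) :
    ∏ i, f i = f j * f l * ∏ i ∈ (Finset.univ.erase j).erase l, f i := by
  rw [← Finset.mul_prod_erase _ _ (Finset.mem_univ j),
    ← Finset.mul_prod_erase (Finset.univ.erase j) f (a := l)
      (by simp [hjl.symm]), mul_assoc]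

/-- The factor at `inr j` becomes `d (σ (inl l)) = -d (σ (inr l))`, and its minus sign cancels that
of the transposition. -/
lemma pairWeight_swap_inr_inl (d : ι ⊕ ι → ℤ) (h0 : ∀ s, d s ≠ 0) {j l : ι} (hjl : j ≠ l)
    (σ : Perm (ι ⊕ ι)) (hl : pairFreq d σ l = 0) :
    pairWeight d (σ * swap (Sum.inr j) (Sum.inl l))
      = pairWeight d σ * ((d (σ (Sum.inr l)) : ℂ) / d (σ (Sum.inr j))) := by
  have h1 : d (σ (Sum.inl l)) = - d (σ (Sum.inr l)) := by
    unfold pairFreq at hl; omega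
  have h2 : (d (σ (Sum.inr j)) : ℂ) ≠ 0 := by exact_mod_cast h0 _
  unfold pairWeight
  rw [prod_split_two hjl, prod_split_two hjl (fun i => (d (σ (Sum.inr i)) : ℂ))]
  have h3 : ∏ i ∈ (Finset.univ.erase j).erase l,
        (d ((σ * swap (Sum.inr j) (Sum.inl l)) (Sum.inr i)) : ℂ)
      = ∏ i ∈ (Finset.univ.erase j).erase l, (d (σ (Sum.inr i)) : ℂ) := by
    refine Finset.prod_congr rfl fun i hi => ?_
    have hj : i ≠ j := by simp at hi; tauto
    simp [swap_apply_def, hj]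
  rw [h3]
  simp only [Perm.sign_mul, Perm.mul_apply, swap_apply_left]
  rw [Perm.sign_swap (by simp), swap_apply_of_ne_of_ne (by simpa using hjl.symm) (by simp), h1]
  push_cast
  field_simp

/-- The two factors only trade places, so the sign of the transposition is all that remains. -/
lemma pairWeight_swap_inr_inr (d : ι ⊕ ι → ℤ) {j l : ι} (hjl : j ≠ l) (σ : Perm (ι ⊕ ι)) :
    pairWeight d (σ * swap (Sum.inr j : ι ⊕ ι) (Sum.inr l)) = - pairWeight d σ := by
  unfold pairWeight
  rw [prod_split_two hjl, prod_split_two hjl (fun i => (d (σ (Sum.inr i)) : ℂ))]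
  have h3 : ∏ i ∈ (Finset.univ.erase j).erase l,
        (d ((σ * swap (Sum.inr j : ι ⊕ ι) (Sum.inr l)) (Sum.inr i)) : ℂ)
      = ∏ i ∈ (Finset.univ.erase j).erase l, (d (σ (Sum.inr i)) : ℂ) := by
    refine Finset.prod_congr rfl fun i hi => ?_
    have hj : i ≠ j ∧ i ≠ l := by simp at hi; tauto
    simp [swap_apply_def, hj.1, hj.2]
  rw [h3]
  simp only [Perm.sign_mul, Perm.mul_apply, swap_apply_left, swap_apply_right]
  rw [Perm.sign_swap (by simpa using hjl)]
  push_cast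
  ring

open Classical in
/-- The sum over assignments with frequencies `-k` and `k` on two pairs, as a sum over balanced
assignments. -/
lemma pairSum_two {d : ι ⊕ ι → ℤ} (hd : Function.Injective d) {ν : ι ⊕ ι → ι ⊕ ι}
    (hν : ∀ s, d (ν s) = - d s) (h0 : ∀ s, d s ≠ 0) {j l : ι} (hjl : j ≠ l) {k : ℤ}
    (hk : k ≠ 0) :
    pairSum d (Pi.single j (-k) + Pi.single l k) =
      ∑ σ : Perm (ι ⊕ ι), (if (∀ i, pairFreq d σ i = 0) then pairWeight d σ *
        (if d (σ (Sum.inr j)) + d (σ (Sum.inr l)) = k then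
          (d (σ (Sum.inr l)) : ℂ) / d (σ (Sum.inr j)) - 1 else 0) else 0) := by
  have hinj : ∀ σ : Perm (ι ⊕ ι), ∀ s t, d (σ s) = d (σ t) → s = t :=
    fun σ s t h => σ.injective (hd h)
  -- The opposite of the frequency at `inl j` sits at `inl l` or at `inr l`, by `exists_opposite`,
  -- and not at both, by injectivity.
  have hsplit : pairSum d (Pi.single j (-k) + Pi.single l k) =
      (∑ σ : Perm (ι ⊕ ι), if (pairFreq d σ j = -k ∧ pairFreq d σ l = k ∧
          (∀ i, i ≠ j → i ≠ l → pairFreq d σ i = 0)) ∧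
          d (σ (Sum.inl l)) = - d (σ (Sum.inl j)) then pairWeight d σ else 0) +
      ∑ σ : Perm (ι ⊕ ι), if (pairFreq d σ j = -k ∧ pairFreq d σ l = k ∧
          (∀ i, i ≠ j → i ≠ l → pairFreq d σ i = 0)) ∧
          d (σ (Sum.inr l)) = - d (σ (Sum.inl j)) then pairWeight d σ else 0 := by
    unfold pairSum
    rw [← Finset.sum_add_distrib]
    refine Finset.sum_congr rfl fun σ _ => ?_
    simp only [pairFreq_update d hjl]
    by_cases hc : pairFreq d σ j = -k ∧ pairFreq d σ l = k ∧
          (∀ i, i ≠ j → i ≠ l → pairFreq d σ i = 0)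
    · rw [if_pos hc]
      by_cases h1 : d (σ (Sum.inl l)) = - d (σ (Sum.inl j))
      · have h2 : ¬ d (σ (Sum.inr l)) = - d (σ (Sum.inl j)) := by
          intro h2
          have := hinj σ _ _ (h1.trans h2.symm)
          simp at this
        rw [if_pos ⟨hc, h1⟩, if_neg (fun h => h2 h.2), add_zero]
      · have h2 := (exists_opposite hd hν h0 hk hc.1 hc.2.2).resolve_left h1
        rw [if_neg (fun h => h1 h.2), if_pos ⟨hc, h2⟩, zero_add]
    · rw [if_neg hc, if_neg (fun h => hc h.1), if_neg (fun h => hc h.1), add_zero]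
  -- Exchanging `inr j` and `inl l` brings the opposite frequency next to `inl j`. Both pairs become
  -- balanced, and the old total `k` of pair `l` is now read off the two `inr` slots.
  have hfirst : (∑ σ : Perm (ι ⊕ ι), if (pairFreq d σ j = -k ∧ pairFreq d σ l = k ∧
          (∀ i, i ≠ j → i ≠ l → pairFreq d σ i = 0)) ∧
          d (σ (Sum.inl l)) = - d (σ (Sum.inl j)) then pairWeight d σ else 0)
      = ∑ σ : Perm (ι ⊕ ι), (if (∀ i, pairFreq d σ i = 0) then pairWeight d σ *
        (if d (σ (Sum.inr j)) + d (σ (Sum.inr l)) = k then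
          (d (σ (Sum.inr l)) : ℂ) / d (σ (Sum.inr j)) else 0) else 0) := by
    rw [← Equiv.sum_comp (Equiv.mulRight (swap (Sum.inr j) (Sum.inl l)))]
    refine Finset.sum_congr rfl fun σ _ => ?_
    simp only [Equiv.coe_mulRight]
    have e1 : pairFreq d (σ * swap (Sum.inr j) (Sum.inl l)) j
        = d (σ (Sum.inl j)) + d (σ (Sum.inl l)) := by
      simp [pairFreq, swap_apply_def, hjl]
    have e2 : pairFreq d (σ * swap (Sum.inr j) (Sum.inl l)) l
        = d (σ (Sum.inr j)) + d (σ (Sum.inr l)) := by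
      simp [pairFreq, swap_apply_def, hjl.symm]
    have e3 : ∀ i, i ≠ j → i ≠ l → pairFreq d (σ * swap (Sum.inr j) (Sum.inl l)) i
        = pairFreq d σ i := by
      intro i h1 h2
      simp [pairFreq, swap_apply_def, h1, h2]
    have e4 : (σ * swap (Sum.inr j) (Sum.inl l)) (Sum.inl l) = σ (Sum.inr j) := by simp
    have e5 : (σ * swap (Sum.inr j) (Sum.inl l)) (Sum.inl j) = σ (Sum.inl j) := by
      simp [swap_apply_def, hjl]
    simp only [e1, e2, e4, e5]
    by_cases hc : (∀ i, pairFreq d σ i = 0) ∧ d (σ (Sum.inr j)) + d (σ (Sum.inr l)) = k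
    · rw [if_pos hc.1, if_pos hc.2, if_pos, pairWeight_swap_inr_inl d h0 hjl σ (hc.1 l)]
      have hj := hc.1 j
      have hl := hc.1 l
      unfold pairFreq at hj hl
      refine ⟨⟨by omega, hc.2, fun i h1 h2 => ?_⟩, by omega⟩
      rw [e3 i h1 h2, hc.1 i]
    · rw [if_neg]
      · by_cases h1 : ∀ i, pairFreq d σ i = 0
        · rw [if_pos h1, if_neg (fun h => hc ⟨h1, h⟩), mul_zero]
        · rw [if_neg h1]
      · rintro ⟨⟨h1, h2, h3⟩, h4⟩
        refine hc ⟨fun i => ?_, h2⟩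
        by_cases hij : i = j
        · subst hij; unfold pairFreq; omega
        by_cases hil : i = l
        · subst hil; unfold pairFreq; omega
        rw [← e3 i hij hil, h3 i hij hil]
  have hsecond : (∑ σ : Perm (ι ⊕ ι), if (pairFreq d σ j = -k ∧ pairFreq d σ l = k ∧
          (∀ i, i ≠ j → i ≠ l → pairFreq d σ i = 0)) ∧
          d (σ (Sum.inr l)) = - d (σ (Sum.inl j)) then pairWeight d σ else 0)
      = ∑ σ : Perm (ι ⊕ ι), (if (∀ i, pairFreq d σ i = 0) then pairWeight d σ *
        (if d (σ (Sum.inr j)) + d (σ (Sum.inr l)) = k then -1 else 0) else 0) := by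
    -- Here the total `k` shows up on `inr j` and `inl l`. Flipping the balanced pair `l` moves it
    -- to the two `inr` slots, as in the other case.
    rw [← Equiv.sum_comp (Equiv.mulRight (swap (Sum.inr j : ι ⊕ ι) (Sum.inr l))),
      sum_balanced_flip d l]
    refine Finset.sum_congr rfl fun σ _ => ?_
    simp only [Equiv.coe_mulRight]
    have e1 : pairFreq d (σ * swap (Sum.inr j : ι ⊕ ι) (Sum.inr l)) j
        = d (σ (Sum.inl j)) + d (σ (Sum.inr l)) := by
      simp [pairFreq, swap_apply_def]
    have e2 : pairFreq d (σ * swap (Sum.inr j : ι ⊕ ι) (Sum.inr l)) l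
        = d (σ (Sum.inl l)) + d (σ (Sum.inr j)) := by
      simp [pairFreq, swap_apply_def]
    have e3 : ∀ i, i ≠ j → i ≠ l → pairFreq d (σ * swap (Sum.inr j : ι ⊕ ι) (Sum.inr l)) i
        = pairFreq d σ i := by
      intro i h1 h2
      simp [pairFreq, swap_apply_def, h1, h2]
    have e4 : (σ * swap (Sum.inr j : ι ⊕ ι) (Sum.inr l)) (Sum.inr l) = σ (Sum.inr j) := by simp
    have e5 : (σ * swap (Sum.inr j : ι ⊕ ι) (Sum.inr l)) (Sum.inl j) = σ (Sum.inl j) := by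
      simp [swap_apply_def]
    have e6 : (σ * flip l) (Sum.inr j) = σ (Sum.inr j) := by
      simp [flip, swap_apply_def, hjl]
    have e7 : (σ * flip l) (Sum.inr l) = σ (Sum.inl l) := by
      simp [flip]
    simp only [e1, e2, e4, e5, e6, e7]
    by_cases hc : (∀ i, pairFreq d σ i = 0) ∧ d (σ (Sum.inr j)) + d (σ (Sum.inl l)) = k
    · rw [if_pos hc.1, if_pos hc.2, if_pos, pairWeight_swap_inr_inr d hjl σ, mul_neg, mul_one]
      have hj := hc.1 j
      have hl := hc.1 l
      unfold pairFreq at hj hl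
      refine ⟨⟨by omega, by omega, fun i h1 h2 => ?_⟩, by omega⟩
      rw [e3 i h1 h2, hc.1 i]
    · rw [if_neg]
      · by_cases h1 : ∀ i, pairFreq d σ i = 0
        · rw [if_pos h1, if_neg (fun h => hc ⟨h1, h⟩), mul_zero]
        · rw [if_neg h1]
      · rintro ⟨⟨h1, h2, h3⟩, h4⟩
        refine hc ⟨fun i => ?_, by omega⟩
        by_cases hij : i = j
        · subst hij; unfold pairFreq; omega
        by_cases hil : i = l
        · subst hil; unfold pairFreq; omega
        rw [← e3 i hij hil, h3 i hij hil]
  rw [hsplit, hfirst, hsecond, ← Finset.sum_add_distrib]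
  refine Finset.sum_congr rfl fun σ _ => ?_
  split_ifs <;> ring

/-- The ratio of the weights of an assignment with frequencies `-k`, `k` and of a balanced one. -/
def pairRatio (k a b : ℤ) : ℂ := if a + b = k then (b : ℂ) / a - 1 else 0

lemma pairRatio_self (k a : ℤ) (ha : a ≠ 0) : pairRatio k a a = 0 := by
  have : (a : ℂ) ≠ 0 := by exact_mod_cast ha
  simp [pairRatio, this]

lemma pairRatio_neg (k a b : ℤ) (hk : k ≠ 0) (h : a + b = 0) : pairRatio k a b = 0 := by
  rw [pairRatio, if_neg (by omega)]

open Classical in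
/-- The sum over all ordered pairs of distinct indices of the assignments with frequencies `-k` and
`k` there. -/
lemma sum_pairSum_two {d : ι ⊕ ι → ℤ} (hd : Function.Injective d) {ν : ι ⊕ ι → ι ⊕ ι}
    (hν : ∀ s, d (ν s) = - d s) (h0 : ∀ s, d s ≠ 0) {k : ℤ} (hk : k ≠ 0) :
    ∑ j : ι, ∑ l : ι, (if j = l then 0 else pairSum d (Pi.single j (-k) + Pi.single l k)) =
      1 / 4 * (∑ s, ∑ t, pairRatio k (d s) (d t)) * pairSum d 0 := by
  -- Averaging over the flips of pairs `j` and `l` produces all four choices of slots. The terms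
  -- with `j = l` may then be included, because `pairRatio` vanishes at equal and at opposite
  -- frequencies.
  have hsym : ∀ j l : ι,
      (if j = l then 0 else pairSum d (Pi.single j (-k) + Pi.single l k)) =
      1 / 4 * ∑ σ : Perm (ι ⊕ ι), (if (∀ i, pairFreq d σ i = 0) then pairWeight d σ *
        (pairRatio k (d (σ (Sum.inr j))) (d (σ (Sum.inr l)))
        + pairRatio k (d (σ (Sum.inl j))) (d (σ (Sum.inr l)))
        + pairRatio k (d (σ (Sum.inr j))) (d (σ (Sum.inl l)))
        + pairRatio k (d (σ (Sum.inl j))) (d (σ (Sum.inl l)))) else 0) := by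
    intro j l
    by_cases hjl : j = l
    · subst hjl
      rw [if_pos rfl, Finset.sum_eq_zero, mul_zero]
      intro σ _
      split_ifs with h
      · have := h j
        unfold pairFreq at this
        rw [pairRatio_self _ _ (h0 _), pairRatio_self _ _ (h0 _), pairRatio_neg _ _ _ hk this,
          pairRatio_neg _ _ _ hk (by omega)]
        simp
      · rfl
    · rw [if_neg hjl, pairSum_two hd hν h0 hjl hk]
      change ∑ σ : Perm (ι ⊕ ι), (if (∀ i, pairFreq d σ i = 0) then pairWeight d σ *
        pairRatio k (d (σ (Sum.inr j))) (d (σ (Sum.inr l))) else 0) = _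
      have a1 := sum_balanced_flip d j
        (fun σ => pairRatio k (d (σ (Sum.inr j))) (d (σ (Sum.inr l))))
      have a2 := sum_balanced_flip d l
        (fun σ => pairRatio k (d (σ (Sum.inr j))) (d (σ (Sum.inr l))))
      have a3 := sum_balanced_flip d l
        (fun σ => pairRatio k (d ((σ * flip j) (Sum.inr j))) (d ((σ * flip j) (Sum.inr l))))
      have b1 : ∀ σ : Perm (ι ⊕ ι), (σ * flip j) (Sum.inr j) = σ (Sum.inl j) := by
        intro σ; simp [flip]
      have b2 : ∀ σ : Perm (ι ⊕ ι), (σ * flip l) (Sum.inr l) = σ (Sum.inl l) := by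
        intro σ; simp [flip]
      have b3 : ∀ σ : Perm (ι ⊕ ι), (σ * flip j) (Sum.inr l) = σ (Sum.inr l) := by
        intro σ; simp [flip, swap_apply_def, Ne.symm hjl]
      have b4 : ∀ σ : Perm (ι ⊕ ι), (σ * flip l) (Sum.inr j) = σ (Sum.inr j) := by
        intro σ; simp [flip, swap_apply_def, hjl]
      have b5 : ∀ σ : Perm (ι ⊕ ι), (σ * flip l) (Sum.inl j) = σ (Sum.inl j) := by
        intro σ; simp [flip, swap_apply_def, hjl]
      simp only [b1, b2, b3, b4, b5] at a1 a2 a3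
      have hsum : ∀ σ : Perm (ι ⊕ ι), (if (∀ i, pairFreq d σ i = 0) then pairWeight d σ *
        (pairRatio k (d (σ (Sum.inr j))) (d (σ (Sum.inr l)))
        + pairRatio k (d (σ (Sum.inl j))) (d (σ (Sum.inr l)))
        + pairRatio k (d (σ (Sum.inr j))) (d (σ (Sum.inl l)))
        + pairRatio k (d (σ (Sum.inl j))) (d (σ (Sum.inl l)))) else 0) =
        (if (∀ i, pairFreq d σ i = 0) then pairWeight d σ *
          pairRatio k (d (σ (Sum.inr j))) (d (σ (Sum.inr l))) else 0) +
        (if (∀ i, pairFreq d σ i = 0) then pairWeight d σ *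
          pairRatio k (d (σ (Sum.inl j))) (d (σ (Sum.inr l))) else 0) +
        (if (∀ i, pairFreq d σ i = 0) then pairWeight d σ *
          pairRatio k (d (σ (Sum.inr j))) (d (σ (Sum.inl l))) else 0) +
        (if (∀ i, pairFreq d σ i = 0) then pairWeight d σ *
          pairRatio k (d (σ (Sum.inl j))) (d (σ (Sum.inl l))) else 0) := by
        intro σ
        split_ifs <;> ring
      simp only [hsum, Finset.sum_add_distrib]
      rw [← a3, ← a2, ← a1]
      ring
  simp only [hsym, ← Finset.mul_sum]
  rw [mul_assoc]
  congr 1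
  unfold pairSum
  rw [Finset.mul_sum]
  simp_rw [Finset.sum_comm (s := (Finset.univ : Finset ι))
    (t := (Finset.univ : Finset (Perm (ι ⊕ ι))))]
  refine Finset.sum_congr rfl fun σ _ => ?_
  simp only [Pi.zero_apply]
  split_ifs with h
  -- The double sum runs over all slots, which `σ` merely permutes; it is therefore independent of
  -- `σ` and factors out.
  · rw [← Equiv.sum_comp σ]
    simp_rw [← Equiv.sum_comp σ (fun t => pairRatio k _ (d t)), Fintype.sum_sum_type]
    rw [mul_comm]
    simp only [← Finset.mul_sum, ← Finset.sum_add_distrib]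
    congr 1
    refine Finset.sum_congr rfl fun j _ => Finset.sum_congr rfl fun l _ => ?_
    ring
  · simp

end Pairings

/-! ### The confluent Vandermonde determinant as a limit of coalescing variables. -/

section ConfluentVandermonde

open Matrix Filter Topology

variable {N : ℕ}

/-- The column exponent `0, …, 2 N - 1` of a slot. -/
def colExp (s : Fin N ⊕ Fin N) : ℕ := (finSumFinEquiv s : Fin (N + N))

/-- The Vandermonde matrix in the `2 N` variables `x` and `y`, indexed by slots. -/
def doubleVandermonde (x y : Fin N → ℂ) : Matrix (Fin N ⊕ Fin N) (Fin N ⊕ Fin N) ℂ :=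
  fun s t => (Sum.elim x y s) ^ colExp t

lemma prod_Ioi_eq_prod_ite {n : ℕ} (f : Fin n → Fin n → ℂ) :
    ∏ i, ∏ j ∈ Finset.Ioi i, f i j = ∏ i, ∏ j, if i < j then f i j else 1 := by
  refine Finset.prod_congr rfl fun i _ => ?_
  rw [← Finset.prod_filter, Finset.filter_lt_eq_Ioi]

lemma det_doubleVandermonde (x y : Fin N → ℂ) :
    (doubleVandermonde x y).det =
      (∏ i, ∏ j ∈ Finset.Ioi i, (x j - x i)) * (∏ i, ∏ j ∈ Finset.Ioi i, (y j - y i)) *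
        ∏ i, ∏ j, (y j - x i) := by
  have h : doubleVandermonde x y
      = (vandermonde (fun i : Fin (N + N) => Sum.elim x y (finSumFinEquiv.symm i))).submatrix
          finSumFinEquiv finSumFinEquiv := by
    ext s t
    simp [doubleVandermonde, colExp, vandermonde_apply]
  rw [h, det_submatrix_equiv_self, det_vandermonde]
  simp only [prod_Ioi_eq_prod_ite]
  rw [Fin.prod_univ_add]
  simp only [Fin.prod_univ_add, finSumFinEquiv_symm_apply_castAdd,
    finSumFinEquiv_symm_apply_natAdd, Sum.elim_inl, Sum.elim_inr, Finset.prod_mul_distrib]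
  have h1 : ∀ i j : Fin N, Fin.castAdd N i < Fin.natAdd N j := fun i j => by
    rw [Fin.lt_def]; simp; omega
  have h2 : ∀ i j : Fin N, ¬ Fin.natAdd N i < Fin.castAdd N j := fun i j => by
    rw [Fin.lt_def]; simp; omega
  have h3 : ∀ i j : Fin N, Fin.castAdd N i < Fin.castAdd N j ↔ i < j := fun i j => by
    rw [Fin.lt_def, Fin.lt_def]; simp
  have h4 : ∀ i j : Fin N, Fin.natAdd N i < Fin.natAdd N j ↔ i < j := fun i j => by
    rw [Fin.lt_def, Fin.lt_def]; simp
  simp only [h1, h2, h3, h4, if_true, if_false, Finset.prod_const_one]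
  ring

/-- The confluent Vandermonde matrix, with the derivative rows shifted by multiples of the value
rows. -/
def confluentMatrix (c : ℂ) (x : Fin N → ℂ) : Matrix (Fin N ⊕ Fin N) (Fin N ⊕ Fin N) ℂ :=
  fun s t => Sum.elim (fun j => x j ^ colExp t) (fun j => ((colExp t : ℂ) - c) * x j ^ colExp t) s

/-- The limit of a second-block entry when `y = x (1 + h)`: subtract `1 + c h` times the value row
and divide by `h`. The term `c h` yields the shift by `c`. -/
lemma tendsto_difference_quotient (c : ℂ) (n : ℕ) :
    Tendsto (fun h : ℂ => h⁻¹ * ((1 + h) ^ n - (1 + c * h))) (𝓝[≠] 0) (𝓝 ((n : ℂ) - c)) := by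
  have hd : HasDerivAt (fun h : ℂ => (1 + h) ^ n - (1 + c * h)) ((n : ℂ) - c) 0 := by
    have h1 : HasDerivAt (fun h : ℂ => (1 + h) ^ n) ((n : ℂ) * (1 + 0) ^ (n - 1) * 1) 0 :=
      ((hasDerivAt_id (0 : ℂ)).const_add 1).pow n
    have h2 : HasDerivAt (fun h : ℂ => 1 + c * h) (c * 1) 0 :=
      ((hasDerivAt_id (0 : ℂ)).const_mul c).const_add 1
    have h3 := h1.sub h2
    rw [add_zero, one_pow, mul_one, mul_one, mul_one] at h3
    exact h3
  have := hd.tendsto_slope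
  refine this.congr' ?_
  filter_upwards with h
  simp [slope_def_field]
  ring

/-- The confluent Vandermonde determinant. -/
lemma det_confluentMatrix (c : ℂ) (x : Fin N → ℂ) :
    (confluentMatrix c x).det =
      (∏ i, ∏ j ∈ Finset.Ioi i, (x j - x i)) ^ 2 * (∏ i, x i) *
        ∏ i, ∏ j ∈ {i}ᶜ, (x j - x i) := by
  let L : ℂ → Matrix (Fin N ⊕ Fin N) (Fin N ⊕ Fin N) ℂ := fun h =>
    fromBlocks 1 0 ((-(h⁻¹ * (1 + c * h))) • (1 : Matrix (Fin N) (Fin N) ℂ))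
      (h⁻¹ • (1 : Matrix (Fin N) (Fin N) ℂ))
  let V : ℂ → Matrix (Fin N ⊕ Fin N) (Fin N ⊕ Fin N) ℂ := fun h =>
    doubleVandermonde x (fun j => x j * (1 + h))
  have hL : ∀ h, (L h).det = (h⁻¹) ^ N := fun h => by
    simp [L, det_fromBlocks_zero₁₂]
  have hdet : ∀ h : ℂ, h ≠ 0 → (L h * V h).det =
      (∏ i, ∏ j ∈ Finset.Ioi i, (x j - x i)) *
        (∏ i, ∏ j ∈ Finset.Ioi i, (x j * (1 + h) - x i * (1 + h))) *
        ((∏ i, x i) * ∏ i, ∏ j ∈ {i}ᶜ, (x j * (1 + h) - x i)) := by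
    intro h hh
    rw [det_mul, hL, det_doubleVandermonde]
    -- The `N` diagonal cross factors equal `h * x i`; their powers of `h` cancel the determinant of
    -- `L h`.
    have : ∏ i, ∏ j, (x j * (1 + h) - x i)
        = h ^ N * ((∏ i, x i) * ∏ i, ∏ j ∈ {i}ᶜ, (x j * (1 + h) - x i)) := by
      have h1 : ∀ i, ∏ j, (x j * (1 + h) - x i)
          = (h * x i) * ∏ j ∈ {i}ᶜ, (x j * (1 + h) - x i) := by
        intro i
        rw [Fintype.prod_eq_mul_prod_compl i]
        ring
      simp only [h1, Finset.prod_mul_distrib, Finset.prod_const, Finset.card_univ, Fintype.card_fin]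
      ring
    rw [this]
    have : (h⁻¹) ^ N * h ^ N = 1 := by rw [← mul_pow, inv_mul_cancel₀ hh, one_pow]
    linear_combination (∏ i, ∏ j ∈ Finset.Ioi i, (x j - x i)) *
        (∏ i, ∏ j ∈ Finset.Ioi i, (x j * (1 + h) - x i * (1 + h))) *
        ((∏ i, x i) * ∏ i, ∏ j ∈ {i}ᶜ, (x j * (1 + h) - x i)) * this
  have hlim1 : Tendsto (fun h => (L h * V h).det) (𝓝[≠] 0) (𝓝 (confluentMatrix c x).det) := by
    have hc : Continuous (fun M : Matrix (Fin N ⊕ Fin N) (Fin N ⊕ Fin N) ℂ => M.det) :=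
      continuous_id.matrix_det
    refine (hc.tendsto _).comp ?_
    refine tendsto_pi_nhds.2 fun s => tendsto_pi_nhds.2 fun t => ?_
    rcases s with i | i
    · have : ∀ h, (L h * V h) (Sum.inl i) t = x i ^ colExp t := by
        intro h
        simp [L, V, Matrix.mul_apply, Fintype.sum_sum_type, Matrix.one_apply, doubleVandermonde]
      simp only [this]
      exact tendsto_const_nhds
    · have : ∀ h, (L h * V h) (Sum.inr i) t
          = h⁻¹ * ((1 + h) ^ colExp t - (1 + c * h)) * x i ^ colExp t := by
        intro h
        simp [L, V, Matrix.mul_apply, Fintype.sum_sum_type, Matrix.one_apply, doubleVandermonde,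
          mul_pow]
        ring
      simp only [this]
      exact (tendsto_difference_quotient c _).mul_const _
  have hlim2 : Tendsto (fun h => (∏ i, ∏ j ∈ Finset.Ioi i, (x j - x i)) *
        (∏ i, ∏ j ∈ Finset.Ioi i, (x j * (1 + h) - x i * (1 + h))) *
        ((∏ i, x i) * ∏ i, ∏ j ∈ {i}ᶜ, (x j * (1 + h) - x i))) (𝓝[≠] 0)
      (𝓝 ((∏ i, ∏ j ∈ Finset.Ioi i, (x j - x i)) *
        (∏ i, ∏ j ∈ Finset.Ioi i, (x j * (1 + 0) - x i * (1 + 0))) *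
        ((∏ i, x i) * ∏ i, ∏ j ∈ {i}ᶜ, (x j * (1 + 0) - x i)))) := by
    refine Tendsto.mono_left (Continuous.tendsto ?_ (0 : ℂ)) nhdsWithin_le_nhds
    fun_prop
  have := tendsto_nhds_unique hlim1
    (hlim2.congr' (by
      filter_upwards [self_mem_nhdsWithin] with h hh
      exact (hdet h hh).symm))
  rw [this]
  simp only [add_zero, mul_one]
  ring

end ConfluentVandermonde

/-! ### Fourier expansion of the density. -/

section Density

variable {N : ℕ}

/-- The column exponent, doubled and centred. -/
def freq (s : Fin N ⊕ Fin N) : ℤ := 2 * (colExp s : ℤ) - (2 * N - 1)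

/-- The exponent of the `j`-th particle in the term of an assignment `σ`. -/
def particleExp (σ : Equiv.Perm (Fin N ⊕ Fin N)) (j : Fin N) : ℤ :=
  (colExp (σ (Sum.inl j)) : ℤ) + colExp (σ (Sum.inr j)) - (2 * N - 1)

lemma pairFreq_freq (σ : Equiv.Perm (Fin N ⊕ Fin N)) (j : Fin N) :
    pairFreq freq σ j = 2 * particleExp σ j := by
  unfold pairFreq freq particleExp; ring

lemma pos_ne_zero (t : Config N) (j : Fin N) : pos t j ≠ 0 := Circle.coe_ne_zero _

lemma norm_pos_eq_one (t : Config N) (j : Fin N) : ‖pos t j‖ = 1 := Circle.norm_coe _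

/-- On the unit circle conjugation is inversion, so |a - b|² = -(b - a)²/(ab); this is its square.
-/
lemma norm_pos_sub_pow_four (t : Config N) (i j : Fin N) :
    ((‖pos t i - pos t j‖ ^ (2 * (2 : ℝ)) : ℝ) : ℂ)
      = (pos t j - pos t i) ^ 4 * ((pos t i * pos t j)⁻¹) ^ 2 := by
  have h1 : (‖pos t i - pos t j‖ ^ (2 * (2 : ℝ)) : ℝ) = (‖pos t i - pos t j‖ ^ 2) ^ 2 := by
    rw [← pow_mul, ← Real.rpow_natCast]; norm_num
  have hn : ∀ k, (starRingEnd ℂ) (pos t k) = (pos t k)⁻¹ := fun k => by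
    rw [Complex.inv_def, Complex.normSq_eq_norm_sq, norm_pos_eq_one]; simp
  rw [h1, Complex.ofReal_pow, ← Complex.normSq_eq_norm_sq, ← Complex.mul_conj, map_sub, hn, hn]
  have := pos_ne_zero t i
  have := pos_ne_zero t j
  field_simp
  ring

lemma prod_Ioi_mul_eq_pow (x : Fin N → ℂ) :
    ∏ i, ∏ j ∈ Finset.Ioi i, (x i * x j) = ∏ i, x i ^ ((N : ℤ) - 1) := by
  have := Finset.prod_prod_Ioi_mul_eq_prod_prod_off_diag (fun _ i : Fin N => x i)
  rw [this]
  refine Finset.prod_congr rfl fun i _ => ?_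
  rw [Finset.prod_const, Finset.card_compl, Finset.card_singleton, Fintype.card_fin,
    ← zpow_natCast, Nat.cast_sub (Fin.pos i)]
  simp

/-- The Fourier expansion of the density of the circular symplectic ensemble. -/
lemma exists_density_eq (N : ℕ) : ∃ s : ℂ, ∀ t : Config N, (density N 2 t : ℂ) =
    s * ∑ σ : Equiv.Perm (Fin N ⊕ Fin N),
      pairWeight freq σ * ∏ j, pos t j ^ particleExp σ j := by
  -- One sign per pair comes from the product of `x j - x i` over ordered pairs, and one factor 1/2
  -- per particle from `freq` being twice the centred exponent. The constant later cancels against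
  -- the normalisation.
  refine ⟨(∏ i : Fin N, ∏ j ∈ Finset.Ioi i, (-1 : ℂ)) * (1 / 2) ^ N, fun t => ?_⟩
  set x := pos t with hx
  have hx0 : ∀ i, x i ≠ 0 := pos_ne_zero t
  have hP : (∏ i, x i) ≠ 0 := Finset.prod_ne_zero_iff.2 fun i _ => hx0 i
  -- The shift `N - 1/2` is the mean of the exponents 0, …, 2N-1, which makes the derivative factors
  -- half of `freq`.
  have h1 : (density N 2 t : ℂ) = (∏ i : Fin N, ∏ j ∈ Finset.Ioi i, (-1 : ℂ)) *
      ((confluentMatrix ((N : ℂ) - 1 / 2) x).det * ∏ i, x i ^ (-(2 * (N : ℤ) - 1))) := by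
    have e1 : (∏ i, ∏ j ∈ Finset.Ioi i, (x i * x j)⁻¹) ^ 2 * (∏ i, x i)⁻¹
        = ∏ i, x i ^ (-(2 * (N : ℤ) - 1)) := by
      simp only [Finset.prod_inv_distrib]
      rw [prod_Ioi_mul_eq_pow x, ← Finset.prod_inv_distrib, ← Finset.prod_inv_distrib,
        ← Finset.prod_pow, ← Finset.prod_mul_distrib]
      refine Finset.prod_congr rfl fun i _ => ?_
      rw [← zpow_neg, ← zpow_natCast, ← zpow_mul, ← zpow_neg_one, ← zpow_add₀ (hx0 i)]
      congr 1
      push_cast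
      ring
    have e2 := Finset.prod_prod_Ioi_mul_eq_prod_prod_off_diag (fun j i : Fin N => x j - x i)
    rw [← e1, det_confluentMatrix, ← e2]
    unfold density
    push_cast
    simp only [← hx]
    have e3 : ∀ i j, ((‖x i - x j‖ ^ (2 * (2 : ℝ)) : ℝ) : ℂ)
      = (x j - x i) ^ 4 * ((x i * x j)⁻¹) ^ 2 := norm_pos_sub_pow_four t
    simp only [e3]
    have e4 : ∀ a b P : ℂ, P ≠ 0 → ∀ q r : ℂ, a * ((q ^ 2 * P * r) * (b * P⁻¹)) =
        a * q ^ 2 * r * b := by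
      intro a b P hP q r; field_simp
    rw [e4 _ _ _ hP]
    simp only [← Finset.prod_pow, ← Finset.prod_mul_distrib]
    refine Finset.prod_congr rfl fun i _ => Finset.prod_congr rfl fun j _ => ?_
    ring
  rw [h1, ← Matrix.det_transpose, Matrix.det_apply', mul_assoc]
  congr 1
  rw [Finset.sum_mul, Finset.mul_sum]
  refine Finset.sum_congr rfl fun σ _ => ?_
  rw [Fintype.prod_sum_type]
  simp only [Matrix.transpose_apply, confluentMatrix, Sum.elim_inl, Sum.elim_inr]
  unfold pairWeight
  have h2 : ∀ j, ((colExp (σ (Sum.inr j)) : ℂ) - ((N : ℂ) - 1 / 2))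
      = 1 / 2 * (freq (σ (Sum.inr j)) : ℂ) := by
    intro j; unfold freq; push_cast; ring
  have h3 : ∀ j, x j ^ particleExp σ j = x j ^ colExp (σ (Sum.inl j)) *
      x j ^ colExp (σ (Sum.inr j)) * x j ^ (-(2 * (N : ℤ) - 1)) := by
    intro j
    rw [← zpow_natCast, ← zpow_natCast, ← zpow_add₀ (hx0 j), ← zpow_add₀ (hx0 j)]
    rfl
  simp only [h2, h3, Finset.prod_mul_distrib, Finset.prod_const, Finset.card_univ,
    Fintype.card_fin]
  ring

instance (N : ℕ) : IsProbabilityMeasure (refMeasure N) := by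
  unfold refMeasure; infer_instance

lemma continuous_pos (j : Fin N) : Continuous fun t : Config N => pos t j :=
  continuous_subtype_val.comp (AddCircle.continuous_toCircle.comp (continuous_apply j))

lemma integral_toCircle_zpow (n : ℤ) :
    ∫ t : UnitAddCircle, (AddCircle.toCircle t : ℂ) ^ n ∂AddCircle.haarAddCircle
      = if n = 0 then 1 else 0 := by
  have h := congrFun (fourierCoeff_fourier (T := 1) n) 0
  rw [fourierCoeff] at h
  have h1 : ∀ t : UnitAddCircle, (AddCircle.toCircle t : ℂ) ^ n
      = fourier (-0) t • fourier n t := by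
    intro t
    simp [fourier_apply, AddCircle.toCircle_zsmul]
  simp only [h1]
  rw [h, Pi.single_apply]
  simp [eq_comm]

lemma integral_prod_zpow (m : Fin N → ℤ) :
    ∫ t, ∏ j, pos t j ^ m j ∂(refMeasure N) = if (∀ j, m j = 0) then 1 else 0 := by
  unfold refMeasure pos
  rw [integral_fintype_prod_eq_prod (f := fun j (t : UnitAddCircle) =>
    (AddCircle.toCircle t : ℂ) ^ m j)]
  simp only [integral_toCircle_zpow]
  split_ifs with h
  · simp [h]
  · push Not at h
    obtain ⟨j, hj⟩ := h
    exact Finset.prod_eq_zero (Finset.mem_univ j) (by simp [hj])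

lemma continuous_prod_zpow (m : Fin N → ℤ) :
    Continuous fun t : Config N => ∏ j, pos t j ^ m j :=
  continuous_finsetProd _ fun j _ => (continuous_pos j).zpow₀ _ fun t => Or.inl (pos_ne_zero t j)

lemma integrable_of_continuous {f : Config N → ℂ} (hf : Continuous f) :
    Integrable f (refMeasure N) :=
  hf.integrable_of_hasCompactSupport (HasCompactSupport.of_compactSpace f)

/-- Fourier coefficients of the density. -/
lemma exists_integral_density_eq (N : ℕ) : ∃ s : ℂ, ∀ m : Fin N → ℤ,
    ∫ t, (∏ j, pos t j ^ m j) * (density N 2 t : ℂ) ∂(refMeasure N)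
      = s * pairSum freq (fun j => - (2 * m j)) := by
  obtain ⟨s, hs⟩ := exists_density_eq N
  refine ⟨s, fun m => ?_⟩
  have h1 : ∀ t : Config N, (∏ j, pos t j ^ m j) * (density N 2 t : ℂ)
      = ∑ σ : Equiv.Perm (Fin N ⊕ Fin N),
        (s * pairWeight freq σ) * ∏ j, pos t j ^ (m j + particleExp σ j) := by
    intro t
    rw [hs, Finset.mul_sum, Finset.mul_sum]
    refine Finset.sum_congr rfl fun σ _ => ?_
    simp only [zpow_add₀ (pos_ne_zero t _), Finset.prod_mul_distrib]
    ring
  simp only [h1]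
  rw [integral_finsetSum _ fun σ _ =>
    (integrable_of_continuous (continuous_prod_zpow _)).const_mul _]
  unfold pairSum
  rw [Finset.mul_sum]
  refine Finset.sum_congr rfl fun σ _ => ?_
  rw [integral_const_mul, integral_prod_zpow]
  have h2 : (∀ j, m j + particleExp σ j = 0) ↔ ∀ j, pairFreq freq σ j = -(2 * m j) := by
    refine forall_congr' fun j => ?_
    rw [pairFreq_freq]; omega
  simp only [h2]
  split_ifs <;> ring

end Density

/-! ### Averages and second moments of power sums. -/

section Moments

variable {N : ℕ}

lemma continuous_density (N : ℕ) : Continuous (density N 2) := by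
  unfold density
  refine continuous_finsetProd _ fun i _ => continuous_finsetProd _ fun j _ => ?_
  exact ((continuous_pos i).sub (continuous_pos j)).norm.rpow_const fun _ => Or.inr (by norm_num)

lemma density_nonneg (t : Config N) : 0 ≤ density N 2 t :=
  Finset.prod_nonneg fun _ _ => Finset.prod_nonneg fun _ _ => by positivity

/-- The density is continuous, nonnegative, and positive at any configuration of distinct points,
while the reference measure charges open sets. -/
lemma partitionFunction_pos (N : ℕ) : 0 < partitionFunction N 2 := by
  have : (refMeasure N).IsOpenPosMeasure := by
    unfold refMeasure; infer_instance
  have : Infinite UnitAddCircle :=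
    (AddCircle.equivIco (1 : ℝ) 0).infinite_iff.2 (Set.Ico_infinite (by norm_num)).to_subtype
  let e : Fin N ↪ UnitAddCircle := Fin.valEmbedding.trans (Infinite.natEmbedding UnitAddCircle)
  refine (continuous_density N).integral_pos_of_hasCompactSupport_nonneg_nonzero (x := e)
    (HasCompactSupport.of_compactSpace _) density_nonneg (ne_of_gt ?_)
  refine Finset.prod_pos fun i _ => Finset.prod_pos fun j hj => Real.rpow_pos_of_pos ?_ _
  rw [norm_pos_iff, sub_ne_zero]
  intro h
  have h1 : e i = e j := AddCircle.injective_toCircle one_ne_zero (Subtype.ext h)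
  exact (Finset.mem_Ioi.1 hj).ne (e.injective h1)

lemma average_const_mul (c : ℂ) (f : Config N → ℂ) :
    average N 2 (fun t => c * f t) = c * average N 2 f := by
  unfold average
  simp only [mul_assoc, integral_const_mul, mul_div_assoc]

lemma average_one : average N 2 (fun _ => 1) = 1 := by
  have h := (partitionFunction_pos N).ne'
  unfold average
  simp only [one_mul]
  rw [integral_complex_ofReal]
  exact div_self (by exact_mod_cast h)

lemma integrable_mul_density {f : Config N → ℂ} (hf : Continuous f) :
    Integrable (fun t => f t * (density N 2 t : ℂ)) (refMeasure N) :=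
  integrable_of_continuous
    (hf.mul (Complex.continuous_ofReal.comp (continuous_density N)))

lemma average_finsetSum {α : Type*} (A : Finset α) (f : α → Config N → ℂ)
    (hf : ∀ a ∈ A, Continuous (f a)) :
    average N 2 (fun t => ∑ a ∈ A, f a t) = ∑ a ∈ A, average N 2 (f a) := by
  unfold average
  simp only [Finset.sum_mul]
  rw [integral_finsetSum _ fun a ha => integrable_mul_density (hf a ha), Finset.sum_div]

/-- Averages of a dominated series of statistics can be taken term by term. -/
lemma hasSum_average {α : Type*} [Countable α] {F : α → Config N → ℂ} {f : Config N → ℂ}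
    {b : α → ℝ} (hF : ∀ a, Continuous (F a)) (hb : ∀ a t, ‖F a t‖ ≤ b a) (hs : Summable b)
    (hf : ∀ t, HasSum (fun a => F a t) (f t)) :
    HasSum (fun a => average N 2 (F a)) (average N 2 f) := by
  unfold average
  refine HasSum.div_const ?_ _
  obtain ⟨D, hD⟩ := (isCompact_univ (X := Config N)).exists_bound_of_continuousOn
    (continuous_density N).continuousOn
  have hb0 : ∀ a, 0 ≤ b a := fun a => (norm_nonneg _).trans (hb a 0)
  have h1 := hasSum_integral_of_summable_integral_norm (μ := refMeasure N)
    (F := fun a t => F a t * (density N 2 t : ℂ)) (fun a => integrable_mul_density (hF a)) ?_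
  · have h2 : ∀ t, ∑' a, F a t * (density N 2 t : ℂ) = f t * (density N 2 t : ℂ) :=
      fun t => ((hf t).mul_right _).tsum_eq
    simp only [h2] at h1
    exact h1
  · refine Summable.of_nonneg_of_le (fun a => integral_nonneg fun _ => norm_nonneg _)
      (fun a => ?_) (hs.mul_right D)
    have h2 : ∀ t, ‖F a t * (density N 2 t : ℂ)‖ ≤ b a * D := fun t => by
      rw [norm_mul, Complex.norm_real]
      exact mul_le_mul (hb a t) (hD t (Set.mem_univ t)) (norm_nonneg _) (hb0 a)
    calc ∫ t, ‖F a t * (density N 2 t : ℂ)‖ ∂(refMeasure N)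
        ≤ ∫ _, b a * D ∂(refMeasure N) :=
          integral_mono (integrable_mul_density (hF a)).norm (integrable_const _) h2
      _ = b a * D := by simp

/-- Reflection of the column exponents. -/
def reflect (N : ℕ) : Equiv.Perm (Fin N ⊕ Fin N) :=
  (finSumFinEquiv.trans Fin.revPerm).trans finSumFinEquiv.symm

lemma freq_reflect (s : Fin N ⊕ Fin N) : freq (reflect N s) = - freq s := by
  have h : colExp (reflect N s) = N + N - (colExp s + 1) := by
    simp [colExp, reflect, Fin.val_rev]
  have h1 : colExp s < N + N := Fin.is_lt _
  unfold freq
  rw [h]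
  omega

lemma freq_ne_zero (s : Fin N ⊕ Fin N) : freq s ≠ 0 := by
  unfold freq; omega

lemma freq_injective : Function.Injective (freq (N := N)) := by
  intro s t h
  apply finSumFinEquiv.injective
  apply Fin.ext
  change colExp s = colExp t
  unfold freq at h
  omega

lemma sum_freq : ∑ s : Fin N ⊕ Fin N, freq s = 0 := by
  have h := Equiv.sum_comp (reflect N) (freq (N := N))
  simp only [freq_reflect, Finset.sum_neg_distrib] at h
  omega

/-- Rotation invariance on the Fourier side: the pair totals always add up to the sum of all
frequencies, which is zero. -/
lemma pairSum_freq_eq_zero {c : Fin N → ℤ} (hc : ∑ i, c i ≠ 0) : pairSum freq c = 0 := by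
  unfold pairSum
  refine Finset.sum_eq_zero fun σ _ => if_neg fun h => hc ?_
  rw [← Finset.sum_congr rfl fun i _ => h i]
  unfold pairFreq
  rw [Finset.sum_add_distrib, ← Fintype.sum_sum_type (fun s => freq (σ s)), Equiv.sum_comp σ,
    sum_freq]

/-- The power sum `∑ⱼ ζⱼ ^ n`. -/
def powerSum (n : ℤ) (t : Config N) : ℂ := ∑ j, pos t j ^ n

lemma continuous_powerSum (n : ℤ) : Continuous (powerSum (N := N) n) :=
  continuous_finsetSum _ fun j _ => (continuous_pos j).zpow₀ _ fun t => Or.inl (pos_ne_zero t j)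

lemma norm_powerSum_le (n : ℤ) (t : Config N) : ‖powerSum n t‖ ≤ N := by
  unfold powerSum
  refine (norm_sum_le _ _).trans ?_
  simp [norm_zpow, norm_pos_eq_one]

lemma powerSum_zero (t : Config N) : powerSum 0 t = N := by simp [powerSum]

lemma powerSum_mul_powerSum (m n : ℤ) (t : Config N) :
    powerSum m t * powerSum n t =
      ∑ j : Fin N, ∑ l : Fin N, ∏ i, pos t i ^ (Pi.single j m + Pi.single l n : Fin N → ℤ) i := by
  unfold powerSum
  rw [Finset.sum_mul_sum]
  refine Finset.sum_congr rfl fun j _ => Finset.sum_congr rfl fun l _ => ?_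
  simp only [Pi.add_apply, zpow_add₀ (pos_ne_zero t _), Finset.prod_mul_distrib]
  have h : ∀ (j : Fin N) (m : ℤ),
      ∏ i, pos t i ^ (Pi.single j m : Fin N → ℤ) i = pos t j ^ m := by
    intro j m
    rw [Finset.prod_eq_single j (fun i _ hi => by simp [hi]) (by simp)]
    simp
  rw [h, h]

/-- Ratios of Fourier coefficients of the density. -/
lemma average_prod_zpow (m : Fin N → ℤ) :
    average N 2 (fun t => ∏ j, pos t j ^ m j)
      = pairSum freq (fun j => - (2 * m j)) / pairSum (freq (N := N)) 0 := by
  obtain ⟨s, hs⟩ := exists_integral_density_eq N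
  have hZ : (partitionFunction N 2 : ℂ) = s * pairSum (freq (N := N)) 0 := by
    have := hs 0
    simp only [Pi.zero_apply, zpow_zero, Finset.prod_const_one, one_mul, mul_zero, neg_zero] at this
    rw [integral_complex_ofReal] at this
    exact this
  have hZ0 : (partitionFunction N 2 : ℂ) ≠ 0 := by exact_mod_cast (partitionFunction_pos N).ne'
  have hs0 : s ≠ 0 := by
    rintro rfl
    exact hZ0 (by rw [hZ, zero_mul])
  unfold average
  rw [hs, hZ, mul_div_mul_left _ _ hs0]

/-- Otherwise the quotient in `average_prod_zpow` at `m = 0` would be a division by zero, hence 0,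
against ⟨1⟩ = 1. -/
lemma pairSum_freq_zero_ne : pairSum (freq (N := N)) 0 ≠ 0 := by
  intro h
  have := average_prod_zpow (N := N) 0
  simp only [Pi.zero_apply, zpow_zero, Finset.prod_const_one, average_one, h, div_zero] at this
  exact one_ne_zero this

lemma average_powerSum_mul (m n : ℤ) :
    average N 2 (fun t => powerSum m t * powerSum n t) =
      ∑ j : Fin N, ∑ l : Fin N, average N 2
        (fun t => ∏ i, pos t i ^ (Pi.single j m + Pi.single l n : Fin N → ℤ) i) := by
  simp only [powerSum_mul_powerSum]
  rw [average_finsetSum _ _ fun j _ => continuous_finsetSum _ fun l _ => continuous_prod_zpow _]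
  exact Finset.sum_congr rfl fun j _ => average_finsetSum _ _ fun l _ => continuous_prod_zpow _

lemma average_powerSum_mul_eq_zero {m n : ℤ} (h : m + n ≠ 0) :
    average N 2 (fun t => powerSum m t * powerSum n t) = 0 := by
  rw [average_powerSum_mul]
  refine Finset.sum_eq_zero fun j _ => Finset.sum_eq_zero fun l _ => ?_
  rw [average_prod_zpow, pairSum_freq_eq_zero, zero_div]
  rw [Finset.sum_neg_distrib, ← Finset.mul_sum]
  simp only [Pi.add_apply, Finset.sum_add_distrib, Finset.sum_pi_single', Finset.mem_univ, if_true]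
  simp
  omega

/-- The terms with `j = l` contribute `N`; the others are ratios of pair sums, with `2 * k` in place
of `k` because `freq` doubles the exponents. -/
lemma average_powerSum_mul_neg {k : ℤ} (hk : k ≠ 0) :
    average N 2 (fun t => powerSum k t * powerSum (-k) t) =
      N + 1 / 4 * ∑ s : Fin N ⊕ Fin N, ∑ t : Fin N ⊕ Fin N,
        pairRatio (2 * k) (freq s) (freq t) := by
  rw [average_powerSum_mul]
  have h1 : ∀ j l : Fin N, average N 2
        (fun t => ∏ i, pos t i ^ (Pi.single j k + Pi.single l (-k) : Fin N → ℤ) i)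
      = (if j = l then 1 else 0) +
        (if j = l then 0 else pairSum freq (Pi.single j (-(2 * k)) + Pi.single l (2 * k)))
          / pairSum (freq (N := N)) 0 := by
    intro j l
    split_ifs with h
    · subst h
      rw [← Pi.single_add, add_neg_cancel, Pi.single_zero]
      simp [average_one]
    · rw [average_prod_zpow, zero_add]
      congr 2
      funext i
      simp only [Pi.add_apply, Pi.single_apply]
      split_ifs <;> ring
  simp only [h1, Finset.sum_add_distrib, ← Finset.sum_div]
  have h2 := sum_pairSum_two (freq_injective (N := N)) freq_reflect freq_ne_zero
    (k := 2 * k) (by omega)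
  convert congrArg (fun z => (N : ℂ) + z / pairSum (freq (N := N)) 0) h2 using 1
  · congr 1
    simp
  · rw [mul_div_assoc, div_self pairSum_freq_zero_ne, mul_one]

end Moments

/-! ### Evaluation of the structure factor. -/

section StructureFactor

open Finset

/-- The sum `∑_{e < k} 1 / (2 N - 1 - 2 e)`. -/
def oddHarmonic (N k : ℕ) : ℂ := ∑ e ∈ range k, (2 * (N : ℂ) - 1 - 2 * e)⁻¹

/-- The structure factor `⟨|∑ⱼ ζⱼ ^ k|²⟩` of the circular symplectic ensemble, for `k ≥ 1`. -/
def structureFactor (N k : ℕ) : ℂ :=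
  if k ≤ 2 * N then (k : ℂ) / 2 * (1 + oddHarmonic N k) else N

/-- The terms at `e` and `2 * N - 1 - e` are opposite. -/
lemma oddHarmonic_two_mul (N : ℕ) : oddHarmonic N (2 * N) = 0 := by
  have h := sum_range_reflect (fun e : ℕ => (2 * (N : ℂ) - 1 - 2 * e)⁻¹) (2 * N)
  have h1 : ∑ e ∈ range (2 * N), (2 * (N : ℂ) - 1 - 2 * ((2 * N - 1 - e : ℕ) : ℂ))⁻¹
      = - oddHarmonic N (2 * N) := by
    unfold oddHarmonic
    rw [← sum_neg_distrib]
    refine sum_congr rfl fun e he => ?_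
    have := mem_range.1 he
    rw [← inv_neg]
    congr 1
    rw [Nat.cast_sub (by omega), Nat.cast_sub (by omega)]
    push_cast
    ring
  rw [h1] at h
  change - oddHarmonic N (2 * N) = oddHarmonic N (2 * N) at h
  linear_combination (-1 / 2 : ℂ) * h

lemma two_mul_sub_odd_ne_zero (N e : ℕ) : 2 * (N : ℂ) - 1 - 2 * e ≠ 0 := by
  intro h
  have : (2 * (N : ℤ) - 1 - 2 * e) = 0 := by exact_mod_cast h
  omega

lemma sum_freq_eq_sum_range {N : ℕ} (f : ℤ → ℂ) :
    ∑ s : Fin N ⊕ Fin N, f (freq s) = ∑ e ∈ range (2 * N), f (2 * (e : ℤ) - (2 * N - 1)) := by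
  rw [two_mul N, ← Fin.sum_univ_eq_sum_range (fun e => f (2 * (e : ℤ) - (2 * N - 1))),
    ← Equiv.sum_comp finSumFinEquiv]
  rfl

lemma sum_pairRatio {N k : ℕ} (hk : 1 ≤ k) :
    (N : ℂ) + 1 / 4 * ∑ s : Fin N ⊕ Fin N, ∑ t : Fin N ⊕ Fin N,
        pairRatio (2 * k) (freq s) (freq t) = structureFactor N k := by
  have h1 : ∀ a, ∑ t : Fin N ⊕ Fin N, pairRatio (2 * k) a (freq t)
      = ∑ e ∈ range (2 * N), pairRatio (2 * k) a (2 * (e : ℤ) - (2 * N - 1)) := fun a =>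
    sum_freq_eq_sum_range (pairRatio (2 * k) a)
  simp only [h1]
  rw [sum_freq_eq_sum_range (fun a => ∑ e ∈ range (2 * N),
    pairRatio (2 * k) a (2 * (e : ℤ) - (2 * N - 1)))]
  -- The partner of `e` must satisfy `e + e' = k + 2 * N - 1`, which is possible in the range
  -- exactly when `k ≤ e`. Its ratio is (2k - a)/a - 1 = 2k/a - 2 with a = -(2N - 1 - 2e).
  have h2 : ∀ e ∈ range (2 * N), ∑ e' ∈ range (2 * N),
      pairRatio (2 * k) (2 * (e : ℤ) - (2 * N - 1)) (2 * (e' : ℤ) - (2 * N - 1))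
      = if k ≤ e then - (2 * (k : ℂ)) * (2 * (N : ℂ) - 1 - 2 * e)⁻¹ - 2 else 0 := by
    intro e he
    have he := mem_range.1 he
    split_ifs with hke
    · rw [sum_eq_single (k + 2 * N - 1 - e)]
      · unfold pairRatio
        rw [if_pos (by omega)]
        have h3 : ((2 * ((k + 2 * N - 1 - e : ℕ) : ℤ) - (2 * N - 1) : ℤ) : ℂ)
            = 2 * k - (2 * e - (2 * N - 1)) := by
          rw [Nat.cast_sub (by omega), Nat.cast_sub (by omega)]
          push_cast
          ring
        rw [h3]
        have h4 := two_mul_sub_odd_ne_zero N e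
        have h5 : (((2 * (e : ℤ) - (2 * N - 1) : ℤ)) : ℂ) = - (2 * (N : ℂ) - 1 - 2 * e) := by
          push_cast; ring
        rw [h5]
        field_simp
        ring
      · intro e' he' hne
        have := mem_range.1 he'
        exact if_neg (by omega)
      · intro hn
        exact absurd (mem_range.2 (by omega)) hn
    · refine sum_eq_zero fun e' he' => if_neg ?_
      have := mem_range.1 he'
      omega
  rw [sum_congr rfl h2]
  unfold structureFactor
  split_ifs with hkN
  · obtain ⟨n, hn⟩ := Nat.exists_eq_add_of_le hkN
    have h3 : ∑ e ∈ range (2 * N),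
        (if k ≤ e then - (2 * (k : ℂ)) * (2 * (N : ℂ) - 1 - 2 * e)⁻¹ - 2 else 0)
        = - (2 * (k : ℂ)) * (oddHarmonic N (2 * N) - oddHarmonic N k) - 2 * n := by
      unfold oddHarmonic
      rw [hn, sum_range_add, sum_range_add, sum_eq_zero, zero_add, add_sub_cancel_left]
      · simp [sum_sub_distrib, mul_sum, mul_comm]
      · intro e he
        rw [if_neg (by have := mem_range.1 he; omega)]
    rw [h3, oddHarmonic_two_mul]
    have h4 : (2 * (N : ℂ)) = k + n := by exact_mod_cast hn
    linear_combination (1 / 2 : ℂ) * h4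
  · rw [sum_eq_zero, mul_zero, add_zero]
    intro e he
    rw [if_neg (by have := mem_range.1 he; omega)]

lemma average_powerSum_neg_mul {N k : ℕ} (hk : 1 ≤ k) :
    average N 2 (fun t => powerSum (-(k : ℤ)) t * powerSum k t) = structureFactor N k := by
  rw [← sum_pairRatio hk, ← average_powerSum_mul_neg (by omega)]
  simp only [mul_comm]

end StructureFactor

/-! ### The resolvent function as a power series. -/

section Resolvent

variable {N : ℕ}

/-- The Taylor coefficients of `(1 + w) / (1 - w)`. -/
def herglotzCoeff (k : ℕ) : ℂ := if k = 0 then 1 else 2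

lemma norm_herglotzCoeff_le (k : ℕ) : ‖herglotzCoeff k‖ ≤ 2 := by
  unfold herglotzCoeff; split_ifs <;> norm_num

lemma hasSum_herglotzCoeff {w : ℂ} (hw : ‖w‖ < 1) :
    HasSum (fun k => herglotzCoeff k * w ^ k) ((1 + w) / (1 - w)) := by
  have h1 := ((hasSum_geometric_of_norm_lt_one hw).mul_left 2).sub (hasSum_ite_eq 0 (1 : ℂ))
  have hw1 : 1 - w ≠ 0 := by
    intro h
    have : w = 1 := by linear_combination -h
    rw [this, norm_one] at hw
    exact lt_irrefl _ hw
  have h2 : (fun k => herglotzCoeff k * w ^ k)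
      = fun k => 2 * w ^ k - if k = 0 then 1 else 0 := by
    funext k
    unfold herglotzCoeff
    split_ifs with hk
    · subst hk; norm_num
    · ring
  have h3 : (1 + w) / (1 - w) = 2 * (1 - w)⁻¹ - 1 := by
    field_simp
    ring
  rw [h2, h3]
  exact h1

lemma hasSum_herglotzSum_inner {z : ℂ} (hz : ‖z‖ < 1) (t : Config N) :
    HasSum (fun k : ℕ => herglotzCoeff k * z ^ k * powerSum (-(k : ℤ)) t) (herglotzSum z t) := by
  unfold herglotzSum powerSum
  simp only [Finset.mul_sum]
  refine hasSum_sum fun j _ => ?_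
  have h0 := pos_ne_zero t j
  have h1 : ‖z * (pos t j)⁻¹‖ < 1 := by simpa [norm_pos_eq_one] using hz
  convert hasSum_herglotzCoeff h1 using 1
  · funext k
    rw [mul_pow, zpow_neg, zpow_natCast, inv_pow, mul_assoc]
  · have h2 : pos t j + z = pos t j * (1 + z * (pos t j)⁻¹) := by field_simp
    have h3 : pos t j - z = pos t j * (1 - z * (pos t j)⁻¹) := by field_simp
    rw [h2, h3, mul_div_mul_left _ _ h0]

lemma hasSum_herglotzSum_outer {z : ℂ} (hz : 1 < ‖z‖) (t : Config N) :
    HasSum (fun k : ℕ => -(herglotzCoeff k * (z⁻¹) ^ k * powerSum (k : ℤ) t))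
      (herglotzSum z t) := by
  unfold herglotzSum powerSum
  simp only [Finset.mul_sum, ← Finset.sum_neg_distrib]
  refine hasSum_sum fun j _ => ?_
  have h0 : z ≠ 0 := norm_pos_iff.1 (by linarith)
  have h1 : ‖z⁻¹ * pos t j‖ < 1 := by
    simpa [norm_pos_eq_one] using inv_lt_one_of_one_lt₀ hz
  have h2 : pos t j + z = z * (1 + z⁻¹ * pos t j) := by field_simp; ring
  have h3 : pos t j - z = - (z * (1 - z⁻¹ * pos t j)) := by field_simp; ring
  have h4 : (fun k : ℕ => -(herglotzCoeff k * z⁻¹ ^ k * pos t j ^ (k : ℤ)))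
      = fun k => -(herglotzCoeff k * (z⁻¹ * pos t j) ^ k) := by
    funext k
    rw [mul_pow, zpow_natCast, mul_assoc]
  rw [h2, h3, div_neg, mul_div_mul_left _ _ h0, h4]
  exact (hasSum_herglotzCoeff h1).neg

lemma norm_herglotz_term_le (w : ℂ) (k : ℕ) (n : ℤ) (t : Config N) :
    ‖herglotzCoeff k * w ^ k * powerSum n t‖ ≤ 2 * N * ‖w‖ ^ k := by
  rw [norm_mul, norm_mul, norm_pow]
  calc ‖herglotzCoeff k‖ * ‖w‖ ^ k * ‖powerSum n t‖ ≤ 2 * ‖w‖ ^ k * N := by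
        gcongr
        · exact norm_herglotzCoeff_le k
        · exact norm_powerSum_le n t
    _ = _ := by ring

/-- A first moment is a second moment with the constant factor `powerSum 0 = N`, so it vanishes too.
-/
lemma average_powerSum (hN : 1 ≤ N) {n : ℤ} (hn : n ≠ 0) : average N 2 (powerSum n) = 0 := by
  have h := average_powerSum_mul_eq_zero (N := N) (m := 0) (n := n) (by omega)
  simp only [powerSum_zero] at h
  rw [average_const_mul] at h
  have hN0 : (N : ℂ) ≠ 0 := by exact_mod_cast (by omega : N ≠ 0)
  exact (mul_eq_zero.1 h).resolve_left hN0

lemma average_powerSum_zero : average N 2 (powerSum 0) = N := by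
  have : (powerSum 0 : Config N → ℂ) = fun _ => (N : ℂ) * 1 := by
    funext t; rw [powerSum_zero, mul_one]
  rw [this, average_const_mul, average_one, mul_one]

lemma average_herglotzSum_inner (hN : 1 ≤ N) {z : ℂ} (hz : ‖z‖ < 1) :
    average N 2 (herglotzSum z) = N := by
  have h := hasSum_average (N := N)
    (F := fun (k : ℕ) t => herglotzCoeff k * z ^ k * powerSum (-(k : ℤ)) t)
    (fun k => continuous_const.mul (continuous_powerSum _))
    (fun k t => norm_herglotz_term_le z k _ t)
    ((summable_geometric_of_lt_one (norm_nonneg z) hz).mul_left (2 * (N : ℝ)))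
    (hasSum_herglotzSum_inner hz)
  simp only [average_const_mul] at h
  refine h.unique ?_
  convert hasSum_ite_eq 0 (N : ℂ) using 1
  funext k
  split_ifs with hk
  · subst hk
    simp [herglotzCoeff, average_powerSum_zero]
  · rw [average_powerSum hN (by omega), mul_zero]

lemma average_herglotzSum_outer (hN : 1 ≤ N) {z : ℂ} (hz : 1 < ‖z‖) :
    average N 2 (herglotzSum z) = -N := by
  have hz' : ‖z⁻¹‖ < 1 := by rw [norm_inv]; exact inv_lt_one_of_one_lt₀ hz
  have h := hasSum_average (N := N)
    (F := fun (k : ℕ) t => -(herglotzCoeff k * (z⁻¹) ^ k * powerSum (k : ℤ) t))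
    (fun k => (continuous_const.mul (continuous_powerSum _)).neg)
    (fun k t => (norm_neg _).le.trans (norm_herglotz_term_le z⁻¹ k _ t))
    ((summable_geometric_of_lt_one (norm_nonneg _) hz').mul_left (2 * (N : ℝ)))
    (hasSum_herglotzSum_outer hz)
  simp only [← neg_mul, average_const_mul] at h
  refine h.unique ?_
  convert hasSum_ite_eq 0 (-N : ℂ) using 1
  funext k
  split_ifs with hk
  · subst hk
    simp [herglotzCoeff, average_powerSum_zero]
  · rw [average_powerSum hN (by omega), mul_zero]

lemma hasSum_mul_of_summable_norm {f g : ℕ → ℂ} {a b : ℂ} (hf : HasSum f a) (hg : HasSum g b)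
    (hf' : Summable fun k => ‖f k‖) (hg' : Summable fun k => ‖g k‖) :
    HasSum (fun p : ℕ × ℕ => f p.1 * g p.2) (a * b) := by
  have h := (summable_mul_of_summable_norm hf' hg').hasSum
  rw [← tsum_mul_tsum_of_summable_norm hf' hg', hf.tsum_eq, hg.tsum_eq] at h
  exact h

lemma summable_norm_herglotz_term {w : ℂ} (hw : ‖w‖ < 1) (n : ℕ → ℤ) (t : Config N) :
    Summable fun k : ℕ => ‖herglotzCoeff k * w ^ k * powerSum (n k) t‖ :=
  Summable.of_nonneg_of_le (fun _ => norm_nonneg _)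
    (fun k => norm_herglotz_term_le w k (n k) t)
    ((summable_geometric_of_lt_one (norm_nonneg w) hw).mul_left (2 * (N : ℝ)))

lemma hasSum_herglotzSum_mul {z₁ z₂ : ℂ} (hz₁ : ‖z₁‖ < 1) (hz₂ : 1 < ‖z₂‖) (t : Config N) :
    HasSum (fun p : ℕ × ℕ => (herglotzCoeff p.1 * z₁ ^ p.1 * powerSum (-(p.1 : ℤ)) t) *
      -(herglotzCoeff p.2 * (z₂⁻¹) ^ p.2 * powerSum (p.2 : ℤ) t))
      (herglotzSum z₁ t * herglotzSum z₂ t) := by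
  have hz' : ‖z₂⁻¹‖ < 1 := by rw [norm_inv]; exact inv_lt_one_of_one_lt₀ hz₂
  have h₁ := hasSum_herglotzSum_inner hz₁ t
  have h₂ := hasSum_herglotzSum_outer hz₂ t
  have h₃ := summable_norm_herglotz_term hz₁ (fun k => -(k : ℤ)) t
  have h₄ : Summable fun k : ℕ => ‖-(herglotzCoeff k * (z₂⁻¹) ^ k * powerSum (k : ℤ) t)‖ := by
    simp only [norm_neg]
    exact summable_norm_herglotz_term hz' (fun k => (k : ℤ)) t
  have h := hasSum_mul_of_summable_norm h₁ h₂ h₃ h₄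
  exact h

lemma hasSum_average_mul_terms {z₁ z₂ : ℂ} (hz₁ : ‖z₁‖ < 1) (hz₂ : 1 < ‖z₂‖) :
    HasSum (fun p : ℕ × ℕ => average N 2 (fun t =>
      (herglotzCoeff p.1 * z₁ ^ p.1 * powerSum (-(p.1 : ℤ)) t) *
      -(herglotzCoeff p.2 * (z₂⁻¹) ^ p.2 * powerSum (p.2 : ℤ) t)))
      (average N 2 (fun t => herglotzSum z₁ t * herglotzSum z₂ t)) := by
  have hz' : ‖z₂⁻¹‖ < 1 := by rw [norm_inv]; exact inv_lt_one_of_one_lt₀ hz₂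
  have hs₁ := (summable_geometric_of_lt_one (norm_nonneg z₁) hz₁).mul_left (2 * (N : ℝ))
  have hs₂ := (summable_geometric_of_lt_one (norm_nonneg _) hz').mul_left (2 * (N : ℝ))
  refine hasSum_average (b := fun p => (2 * N * ‖z₁‖ ^ p.1) * (2 * N * ‖z₂⁻¹‖ ^ p.2))
    (fun p => ?_) (fun p t => ?_) ?_ (hasSum_herglotzSum_mul hz₁ hz₂)
  · exact (continuous_const.mul (continuous_powerSum _)).mul
      (continuous_const.mul (continuous_powerSum _)).neg
  · rw [norm_mul, norm_neg]
    exact mul_le_mul (norm_herglotz_term_le _ _ _ _) (norm_herglotz_term_le _ _ _ _)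
      (norm_nonneg _) (by positivity)
  · exact hs₁.mul_of_nonneg hs₂ (fun _ => by positivity) (fun _ => by positivity)

lemma hasSum_average_herglotzSum_mul {z₁ z₂ : ℂ} (hz₁ : ‖z₁‖ < 1) (hz₂ : 1 < ‖z₂‖) :
    HasSum (fun k : ℕ => -(herglotzCoeff k ^ 2 * (z₁ / z₂) ^ k *
        average N 2 (fun t => powerSum (-(k : ℤ)) t * powerSum k t)))
      (average N 2 (fun t => herglotzSum z₁ t * herglotzSum z₂ t)) := by
  have h := hasSum_average_mul_terms (N := N) hz₁ hz₂
  have hterm : ∀ p : ℕ × ℕ, average N 2 (fun t =>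
      (herglotzCoeff p.1 * z₁ ^ p.1 * powerSum (-(p.1 : ℤ)) t) *
      -(herglotzCoeff p.2 * (z₂⁻¹) ^ p.2 * powerSum (p.2 : ℤ) t)) =
      -(herglotzCoeff p.1 * z₁ ^ p.1 * herglotzCoeff p.2 * (z₂⁻¹) ^ p.2) *
        average N 2 (fun t => powerSum (-(p.1 : ℤ)) t * powerSum p.2 t) := by
    intro p
    rw [← average_const_mul]
    congr 1
    funext t
    ring
  simp only [hterm] at h
  -- Only the diagonal of the double series survives, since moments of nonzero total degree vanish.
  have hinj : Function.Injective (fun k : ℕ => (k, k)) := fun a b hab => (Prod.mk.inj hab).1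
  rw [← hinj.hasSum_iff] at h
  · convert h using 1
    funext k
    simp only [Function.comp_apply, div_eq_mul_inv, mul_pow]
    ring
  · rintro ⟨a, b⟩ hab
    have : a ≠ b := fun hab' => hab ⟨a, by simp [hab']⟩
    simp only
    rw [average_powerSum_mul_eq_zero (by omega), mul_zero]

/-- The second resolvent function is the generating function of the structure factor. -/
theorem hasSum_W₂ (hN : 1 ≤ N) {z₁ z₂ : ℂ} (hz₁ : ‖z₁‖ < 1) (hz₂ : 1 < ‖z₂‖) :
    HasSum (fun k : ℕ => -4 * (structureFactor N k * (z₁ / z₂) ^ k)) (W₂ N 2 z₁ z₂) := by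
  have h := (hasSum_average_herglotzSum_mul (N := N) hz₁ hz₂).add (hasSum_ite_eq 0 ((N : ℂ) * N))
  unfold W₂
  rw [average_herglotzSum_inner hN hz₁, average_herglotzSum_outer hN hz₂]
  convert h using 1
  · funext k
    -- At `k = 0` the formula for `structureFactor` gives 0 rather than ⟨p_0²⟩ = N². This is right
    -- for the connected function: subtracting the product N · (-N) of the means cancels the zeroth
    -- term.
    split_ifs with hk
    · subst hk
      have : (fun t : Config N => powerSum (-((0 : ℕ) : ℤ)) t * powerSum ((0 : ℕ) : ℤ) t)
          = fun _ => ((N : ℂ) * N) * 1 := by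
        funext t
        simp [powerSum_zero]
      rw [this, average_const_mul, average_one]
      simp [structureFactor, herglotzCoeff]
    · rw [average_powerSum_neg_mul (by omega), herglotzCoeff, if_neg hk]
      ring
  · ring

end Resolvent

/-! ### Summation to the closed form. -/

section ClosedForm

open Finset

/-- Both sides are the rising factorial of `b` of length `n + 1`. -/
lemma ascPochhammer_eval_add_one_mul (b : ℂ) (n : ℕ) :
    (ascPochhammer ℂ n).eval b * (b + n) = b * (ascPochhammer ℂ n).eval (b + 1) := by
  rw [← ascPochhammer_succ_eval, ascPochhammer_succ_left]
  simp

/-- The series `₂F₁(1, b; b + 1; x) = ∑ b xⁿ / (b + n)`. -/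
lemma ordinaryHypergeometric_one_add_one {b c : ℂ} (hc : c = b + 1) (hb : ∀ n : ℕ, b + n ≠ 0)
    (x : ℂ) : ₂F₁ (1 : ℂ) b c x = ∑' n : ℕ, b * ((b + n)⁻¹ * x ^ n) := by
  subst hc
  rw [ordinaryHypergeometric_eq_tsum]
  refine tsum_congr fun n => ?_
  have h1 := ascPochhammer_eval_add_one_mul b n
  have h2 : (ascPochhammer ℂ n).eval (b + 1) ≠ 0 := by
    rw [Ne, ascPochhammer_eval_eq_zero_iff]
    rintro ⟨k, -, hk⟩
    exact hb (k + 1) (by push_cast; linear_combination hk)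
  have h3 := hb n
  have h4 : ((n.factorial : ℕ) : ℂ) ≠ 0 := by exact_mod_cast n.factorial_ne_zero
  rw [ascPochhammer_eval_one, smul_eq_mul]
  field_simp
  linear_combination x ^ n * h1

lemma norm_two_mul_sub_odd_inv_le (N e : ℕ) : ‖(2 * (N : ℂ) - 1 - 2 * e)⁻¹‖ ≤ 1 := by
  rw [norm_inv]
  refine inv_le_one_of_one_le₀ ?_
  have h : (2 * (N : ℂ) - 1 - 2 * e) = ((2 * (N : ℤ) - 1 - 2 * e : ℤ) : ℂ) := by push_cast; ring
  rw [h, Complex.norm_intCast]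
  have : 1 ≤ |2 * (N : ℤ) - 1 - 2 * e| := Int.one_le_abs (by omega)
  exact_mod_cast this

lemma summable_odd_inv (N : ℕ) {ζ : ℂ} (hζ : ‖ζ‖ < 1) :
    Summable fun e : ℕ => (2 * (N : ℂ) - 1 - 2 * e)⁻¹ * ζ ^ e := by
  refine Summable.of_norm_bounded (summable_geometric_of_lt_one (norm_nonneg _) hζ) fun e => ?_
  rw [norm_mul, norm_pow]
  exact mul_le_of_le_one_left (by positivity) (norm_two_mul_sub_odd_inv_le N e)

/-- The hypergeometric combination in the closed form is a polynomial. -/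
lemma hypergeometric_combination {N : ℕ} (hN : 1 ≤ N) {ζ : ℂ} (hζ : ‖ζ‖ < 1) :
    ζ ^ 2 / (2 * (N : ℂ) - 3) * ₂F₁ (1 : ℂ) (3 / 2 - (N : ℂ)) (5 / 2 - (N : ℂ)) ζ
        + ζ ^ (2 * N) / (2 * (N : ℂ) - 1) * ₂F₁ (1 : ℂ) ((N : ℂ) - 1 / 2) ((N : ℂ) + 1 / 2) ζ
      = ζ * ∑ e ∈ range (2 * N), (2 * (N : ℂ) - 1 - 2 * e)⁻¹ * ζ ^ e
        - ζ / (2 * N - 1) + ζ ^ (2 * N) / (2 * N - 1) := by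
  have h1 : (2 * (N : ℂ) - 1) ≠ 0 := by simpa using two_mul_sub_odd_ne_zero N 0
  have h3 : (2 * (N : ℂ) - 3) ≠ 0 := by
    have := two_mul_sub_odd_ne_zero N 1
    push_cast at this
    intro h
    exact this (by linear_combination h)
  have hT := (summable_odd_inv N hζ).hasSum
  set T := ∑' e : ℕ, (2 * (N : ℂ) - 1 - 2 * e)⁻¹ * ζ ^ e
  obtain ⟨M, rfl⟩ : ∃ M, N = M + 1 := ⟨N - 1, by omega⟩
  -- Both hypergeometric series are tails of `T`: one starts at `e = 1`, the other, with the
  -- opposite sign, at `e = 2 * N - 1 = 2 * M + 1`. In their sum `T` drops out. Completing the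
  -- finite sum up to `2 * N` accounts for the last term of the statement.
  have hA := ((hasSum_nat_add_iff' 1).2 hT).tsum_eq
  have hB := ((hasSum_nat_add_iff' (2 * M + 1)).2 hT).tsum_eq
  have e1 : ∀ n : ℕ, (3 / 2 - ((M + 1 : ℕ) : ℂ)) + n
      = - ((2 * ((M + 1 : ℕ) : ℂ) - 1 - 2 * ((n + 1 : ℕ) : ℂ)) / 2) := by
    intro n; push_cast; ring
  have e2 : ∀ n : ℕ, (((M + 1 : ℕ) : ℂ) - 1 / 2) + n
      = - ((2 * ((M + 1 : ℕ) : ℂ) - 1 - 2 * ((n + (2 * M + 1) : ℕ) : ℂ)) / 2) := by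
    intro n; push_cast; ring
  have hF1 : ζ ^ 2 / (2 * ((M + 1 : ℕ) : ℂ) - 3) *
      ₂F₁ (1 : ℂ) (3 / 2 - ((M + 1 : ℕ) : ℂ)) (5 / 2 - ((M + 1 : ℕ) : ℂ)) ζ
      = ζ * (T - ∑ i ∈ range 1, (2 * ((M + 1 : ℕ) : ℂ) - 1 - 2 * i)⁻¹ * ζ ^ i) := by
    rw [ordinaryHypergeometric_one_add_one (by ring), ← hA, ← tsum_mul_left, ← tsum_mul_left]
    · refine tsum_congr fun n => ?_
      rw [e1]
      have := two_mul_sub_odd_ne_zero (M + 1) (n + 1)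
      have h5 : (3 / 2 - ((M + 1 : ℕ) : ℂ)) = - ((2 * ((M + 1 : ℕ) : ℂ) - 3) / 2) := by ring
      rw [h5]
      field_simp
      ring
    · intro n
      rw [e1]
      have := two_mul_sub_odd_ne_zero (M + 1) (n + 1)
      exact neg_ne_zero.2 (div_ne_zero this two_ne_zero)
  have hF2 : ζ ^ (2 * (M + 1)) / (2 * ((M + 1 : ℕ) : ℂ) - 1) *
      ₂F₁ (1 : ℂ) (((M + 1 : ℕ) : ℂ) - 1 / 2) (((M + 1 : ℕ) : ℂ) + 1 / 2) ζ
      = -(ζ * (T - ∑ i ∈ range (2 * M + 1),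
          (2 * ((M + 1 : ℕ) : ℂ) - 1 - 2 * i)⁻¹ * ζ ^ i)) := by
    rw [ordinaryHypergeometric_one_add_one (by ring), ← hB, ← neg_mul, ← tsum_mul_left,
      ← tsum_mul_left]
    · refine tsum_congr fun n => ?_
      rw [e2]
      have := two_mul_sub_odd_ne_zero (M + 1) (n + (2 * M + 1))
      have h5 : (((M + 1 : ℕ) : ℂ) - 1 / 2) = (2 * ((M + 1 : ℕ) : ℂ) - 1) / 2 := by ring
      rw [h5]
      field_simp
      ring
    · intro n
      rw [e2]
      have := two_mul_sub_odd_ne_zero (M + 1) (n + (2 * M + 1))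
      exact neg_ne_zero.2 (div_ne_zero this two_ne_zero)
  rw [hF1, hF2, show 2 * (M + 1) = (2 * M + 1) + 1 by ring, sum_range_succ _ (2 * M + 1),
    sum_range_one]
  have h6 : (2 * ((M + 1 : ℕ) : ℂ) - 1 - 2 * ((2 * M + 1 : ℕ) : ℂ))
      = -(2 * ((M + 1 : ℕ) : ℂ) - 1) := by push_cast; ring
  rw [h6]
  simp only [Nat.cast_zero, mul_zero, sub_zero, pow_zero, mul_one]
  field_simp
  ring

/-- This identity and the next two are summations by parts: multiplication by `1 - ζ` differences
the coefficients and leaves a boundary term. -/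
lemma one_sub_mul_sum_nat (ζ : ℂ) (n : ℕ) :
    (1 - ζ) * ∑ k ∈ range n, (k : ℂ) * ζ ^ k = ζ * ∑ k ∈ range n, ζ ^ k - n * ζ ^ n := by
  induction n with
  | zero => simp
  | succ n ih =>
    rw [sum_range_succ, sum_range_succ, mul_add, ih]
    push_cast
    ring

lemma one_sub_mul_sum_partial (h : ℕ → ℂ) (ζ : ℂ) (n : ℕ) :
    (1 - ζ) * ∑ k ∈ range n, (∑ e ∈ range k, h e) * ζ ^ k
      = ζ * ∑ k ∈ range n, h k * ζ ^ k - (∑ e ∈ range n, h e) * ζ ^ n := by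
  induction n with
  | zero => simp
  | succ n ih =>
    rw [sum_range_succ, sum_range_succ _ n, sum_range_succ _ n, mul_add, ih]
    ring

lemma one_sub_mul_sum_nat_mul_partial (h : ℕ → ℂ) (ζ : ℂ) (n : ℕ) :
    (1 - ζ) * ∑ k ∈ range n, (k : ℂ) * (∑ e ∈ range k, h e) * ζ ^ k
      = ζ * ∑ k ∈ range n, (∑ e ∈ range k, h e) * ζ ^ k + ζ * ∑ k ∈ range n, k * h k * ζ ^ k
        + ζ * ∑ k ∈ range n, h k * ζ ^ k - n * (∑ e ∈ range n, h e) * ζ ^ n := by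
  induction n with
  | zero => simp
  | succ n ih =>
    rw [sum_range_succ, sum_range_succ _ n, sum_range_succ _ n, sum_range_succ _ n,
      sum_range_succ _ n, mul_add, ih]
    push_cast
    ring

/-- At `k = 0` the two branches of the definition agree, because the odd harmonic sum over the full
range vanishes. -/
lemma structureFactor_add_two_mul (N k : ℕ) : structureFactor N (k + 2 * N) = N := by
  unfold structureFactor
  split_ifs with hk
  · obtain rfl : k = 0 := by omega
    rw [zero_add, oddHarmonic_two_mul]
    push_cast
    ring
  · rfl

/-- From `2 * N` on the coefficients are constant, which gives the geometric term; the finite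
remainder is summed by parts. -/
lemma sum_structureFactor_eq {N : ℕ} (hN : 1 ≤ N) {ζ : ℂ} (hζ : ‖ζ‖ < 1) :
    -4 * (N * ζ ^ (2 * N)) * (1 - ζ)⁻¹
      + ∑ k ∈ range (2 * N), -4 * (structureFactor N k * ζ ^ k) = cseClosedForm N ζ := by
  have hz : 1 - ζ ≠ 0 := by
    intro h
    have : ζ = 1 := by linear_combination -h
    rw [this, norm_one] at hζ
    exact lt_irrefl _ hζ
  set h : ℕ → ℂ := fun e => (2 * (N : ℂ) - 1 - 2 * e)⁻¹ with hh
  have hS : ∑ k ∈ range (2 * N), -4 * (structureFactor N k * ζ ^ k)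
      = -2 * ∑ k ∈ range (2 * N), (k : ℂ) * ζ ^ k
        - 2 * ∑ k ∈ range (2 * N), (k : ℂ) * (∑ e ∈ range k, h e) * ζ ^ k := by
    rw [mul_sum, mul_sum, ← sum_sub_distrib]
    refine sum_congr rfl fun k hk => ?_
    rw [structureFactor, if_pos (mem_range.1 hk).le, oddHarmonic]
    ring
  have a1 := one_sub_mul_sum_nat ζ (2 * N)
  have a2 := one_sub_mul_sum_partial h ζ (2 * N)
  have a3 := one_sub_mul_sum_nat_mul_partial h ζ (2 * N)
  have a4 : ∑ e ∈ range (2 * N), h e = 0 := oddHarmonic_two_mul N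
  -- Here 2k = (2N - 1) - (2N - 1 - 2k), and the second part cancels the denominator of `h k`.
  have a5 : 2 * ∑ k ∈ range (2 * N), (k : ℂ) * h k * ζ ^ k
      = (2 * N - 1) * ∑ k ∈ range (2 * N), h k * ζ ^ k - ∑ k ∈ range (2 * N), ζ ^ k := by
    rw [mul_sum, mul_sum, ← sum_sub_distrib]
    refine sum_congr rfl fun k _ => ?_
    have := two_mul_sub_odd_ne_zero N k
    simp only [hh]
    field_simp
    ring
  have a6 : (1 - ζ) * ∑ k ∈ range (2 * N), ζ ^ k = 1 - ζ ^ (2 * N) := mul_neg_geom_sum ζ _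
  rw [a4] at a2 a3
  rw [hS]
  unfold cseClosedForm
  rw [hypergeometric_combination hN hζ]
  change _ = _ - _ * (ζ * ∑ e ∈ range (2 * N), h e * ζ ^ e - _ + _)
  -- Writing `2 * N = M + 2` removes the truncated subtractions from the exponents.
  obtain ⟨M, hM⟩ : ∃ M, 2 * N = M + 2 := ⟨2 * N - 2, by omega⟩
  have hMc : 2 * (N : ℂ) = M + 2 := by exact_mod_cast hM
  have hM1 : (M : ℂ) + 1 ≠ 0 := by exact_mod_cast M.succ_ne_zero
  have hpred : 2 * N - 1 = M + 1 := by omega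
  have hpred2 : 2 * N - 2 = M := by omega
  rw [hpred, hpred2]
  push_cast at a1 a3
  have hN4 : (-4 : ℂ) * (N * ζ ^ (2 * N)) = -2 * (2 * N * ζ ^ (2 * N)) := by ring
  rw [hN4]
  rw [hMc] at a1 a3 a5 ⊢
  rw [hM] at a1 a2 a3 a5 a6 ⊢
  generalize (∑ k ∈ range (M + 2), (k : ℂ) * ζ ^ k) = A at *
  generalize (∑ k ∈ range (M + 2), (k : ℂ) * (∑ e ∈ range k, h e) * ζ ^ k) = U at *
  generalize (∑ k ∈ range (M + 2), (∑ e ∈ range k, h e) * ζ ^ k) = G at *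
  generalize (∑ k ∈ range (M + 2), (k : ℂ) * h k * ζ ^ k) = Q at *
  generalize (∑ k ∈ range (M + 2), h k * ζ ^ k) = P at *
  generalize (∑ k ∈ range (M + 2), ζ ^ k) = E at *
  -- The relations form a triangular system that expresses every sum through `P`, the polynomial to
  -- which the hypergeometric terms were reduced.
  have c6 : E = (1 - ζ ^ (M + 2)) / (1 - ζ) := by rw [eq_div_iff hz]; linear_combination a6
  have c1 : A = (ζ * E - (M + 2) * ζ ^ (M + 2)) / (1 - ζ) := by
    rw [eq_div_iff hz]; linear_combination a1
  have c2 : G = ζ * P / (1 - ζ) := by rw [eq_div_iff hz]; linear_combination a2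
  have c5 : Q = ((M + 1) * P - E) / 2 := by linear_combination a5 / 2
  have c3 : U = (ζ * G + ζ * Q + ζ * P) / (1 - ζ) := by
    rw [eq_div_iff hz]; linear_combination a3
  have hM3 : (M : ℂ) + 2 - 1 ≠ 0 := by
    intro h0; exact hM1 (by linear_combination h0)
  rw [c3, c1, c2, c5, c6]
  field_simp
  ring

/-- The generating function of the structure factor. -/
theorem hasSum_structureFactor {N : ℕ} (hN : 1 ≤ N) {ζ : ℂ} (hζ : ‖ζ‖ < 1) :
    HasSum (fun k : ℕ => -4 * (structureFactor N k * ζ ^ k)) (cseClosedForm N ζ) := by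
  rw [← sum_structureFactor_eq hN hζ, ← hasSum_nat_add_iff]
  have h := (hasSum_geometric_of_norm_lt_one hζ).mul_left (-4 * (N * ζ ^ (2 * N)))
  have h1 : (fun k : ℕ => -4 * (structureFactor N (k + 2 * N) * ζ ^ (k + 2 * N)))
      = fun k => -4 * (N * ζ ^ (2 * N)) * ζ ^ k := by
    funext k
    rw [structureFactor_add_two_mul]
    ring
  rw [h1]
  exact h

theorem W₂_eq_cseClosedForm {N : ℕ} (hN : 1 ≤ N) {z₁ z₂ : ℂ} (hz₁ : ‖z₁‖ < 1)
    (hz₂ : 1 < ‖z₂‖) : W₂ N 2 z₁ z₂ = cseClosedForm N (z₁ / z₂) := by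
  have hζ : ‖z₁ / z₂‖ < 1 := by
    rw [norm_div, div_lt_one (by linarith)]
    linarith
  exact (hasSum_W₂ hN hz₁ hz₂).unique (hasSum_structureFactor hN hζ)

end ClosedForm

/-! ### Generating functions of powers and of sums of odd powers. -/

section PowerSeries

/-- The power series `∑ₖ kᵐ ζᵏ`. -/
def powerGeometric (m : ℕ) (ζ : ℂ) : ℂ := ∑' k : ℕ, (k : ℂ) ^ m * ζ ^ k

lemma hasSum_powerGeometric {ζ : ℂ} (hζ : ‖ζ‖ < 1) (m : ℕ) :
    HasSum (fun k : ℕ => (k : ℂ) ^ m * ζ ^ k) (powerGeometric m ζ) :=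
  (summable_pow_mul_geometric_of_norm_lt_one m hζ).hasSum

lemma sub_one_ne_zero_of_norm_lt_one {ζ : ℂ} (hζ : ‖ζ‖ < 1) : ζ - 1 ≠ 0 := by
  intro h
  rw [sub_eq_zero.1 h, norm_one] at hζ
  exact lt_irrefl _ hζ

lemma powerGeometric_zero {ζ : ℂ} (hζ : ‖ζ‖ < 1) : powerGeometric 0 ζ = -1 / (ζ - 1) := by
  have h := (hasSum_geometric_of_norm_lt_one hζ).tsum_eq
  unfold powerGeometric
  simp only [pow_zero, one_mul]
  rw [h, ← neg_sub, inv_neg, neg_div, one_div]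

/-- Recursion for the power series `∑ₖ kᵐ ζᵏ` from the binomial expansion of `(k + 1)ᵐ`. -/
lemma sub_one_mul_powerGeometric {ζ : ℂ} (hζ : ‖ζ‖ < 1) {m : ℕ} (hm : m ≠ 0) :
    (ζ - 1) * powerGeometric m ζ
      = -ζ * ∑ j ∈ Finset.range m, (m.choose j : ℂ) * powerGeometric j ζ := by
  have h1 : HasSum (fun k : ℕ => ((k + 1 : ℕ) : ℂ) ^ m * ζ ^ (k + 1)) (powerGeometric m ζ) := by
    have h := (hasSum_nat_add_iff' 1).2 (hasSum_powerGeometric hζ m)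
    simpa [hm] using h
  have h2 : HasSum (fun k : ℕ => ζ * ∑ j ∈ Finset.range (m + 1),
      (m.choose j : ℂ) * ((k : ℂ) ^ j * ζ ^ k))
      (ζ * ∑ j ∈ Finset.range (m + 1), (m.choose j : ℂ) * powerGeometric j ζ) :=
    (hasSum_sum fun j _ => (hasSum_powerGeometric hζ j).mul_left _).mul_left ζ
  have h3 : (fun k : ℕ => ((k + 1 : ℕ) : ℂ) ^ m * ζ ^ (k + 1)) = fun k : ℕ =>
      ζ * ∑ j ∈ Finset.range (m + 1), (m.choose j : ℂ) * ((k : ℂ) ^ j * ζ ^ k) := by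
    funext k
    push_cast
    rw [add_pow, Finset.sum_mul, Finset.mul_sum]
    refine Finset.sum_congr rfl fun j _ => ?_
    ring
  rw [h3] at h1
  have h4 := h1.unique h2
  rw [Finset.sum_range_succ, Nat.choose_self] at h4
  push_cast at h4
  linear_combination -h4

/-- The sum `∑_{e < k} (2 e + 1)ᵐ`. -/
def oddPowerSum (m k : ℕ) : ℂ := ∑ e ∈ Finset.range k, (2 * (e : ℂ) + 1) ^ m

lemma oddPowerSum_succ (m k : ℕ) :
    oddPowerSum m (k + 1) = oddPowerSum m k + (2 * (k : ℂ) + 1) ^ m :=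
  Finset.sum_range_succ _ _

/-- The closed forms for exponents 1 to 10 come from the recursion; their numerators carry the
Eulerian polynomials. Exponent 10 is needed because `k * oddPowerSum 8 k` has degree 10 in `k`. -/
lemma powerGeometric_1 {ζ : ℂ} (hζ : ‖ζ‖ < 1) :
    powerGeometric 1 ζ = (ζ * (1)) / (ζ - 1) ^ 2 := by
  have h := sub_one_mul_powerGeometric hζ (m := 1) (by norm_num)
  have hz := sub_one_ne_zero_of_norm_lt_one hζ
  simp only [Finset.sum_range_succ, Finset.sum_range_zero, powerGeometric_zero hζ] at h
  refine mul_left_cancel₀ hz (h.trans ?_)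
  norm_num [Nat.choose]
  field_simp

lemma powerGeometric_2 {ζ : ℂ} (hζ : ‖ζ‖ < 1) :
    powerGeometric 2 ζ = -(ζ * (1 + ζ)) / (ζ - 1) ^ 3 := by
  have h := sub_one_mul_powerGeometric hζ (m := 2) (by norm_num)
  have hz := sub_one_ne_zero_of_norm_lt_one hζ
  simp only [Finset.sum_range_succ, Finset.sum_range_zero, powerGeometric_zero hζ,
    powerGeometric_1 hζ] at h
  refine mul_left_cancel₀ hz (h.trans ?_)
  norm_num [Nat.choose]
  field_simp
  ring

lemma powerGeometric_3 {ζ : ℂ} (hζ : ‖ζ‖ < 1) :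
    powerGeometric 3 ζ = (ζ * (1 + 4 * ζ + ζ ^ 2)) / (ζ - 1) ^ 4 := by
  have h := sub_one_mul_powerGeometric hζ (m := 3) (by norm_num)
  have hz := sub_one_ne_zero_of_norm_lt_one hζ
  simp only [Finset.sum_range_succ, Finset.sum_range_zero, powerGeometric_zero hζ,
    powerGeometric_1 hζ, powerGeometric_2 hζ] at h
  refine mul_left_cancel₀ hz (h.trans ?_)
  norm_num [Nat.choose]
  field_simp
  ring

lemma powerGeometric_4 {ζ : ℂ} (hζ : ‖ζ‖ < 1) :
    powerGeometric 4 ζ = -(ζ * (1 + 11 * ζ + 11 * ζ ^ 2 + ζ ^ 3)) / (ζ - 1) ^ 5 := by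
  have h := sub_one_mul_powerGeometric hζ (m := 4) (by norm_num)
  have hz := sub_one_ne_zero_of_norm_lt_one hζ
  simp only [Finset.sum_range_succ, Finset.sum_range_zero, powerGeometric_zero hζ,
    powerGeometric_1 hζ, powerGeometric_2 hζ, powerGeometric_3 hζ] at h
  refine mul_left_cancel₀ hz (h.trans ?_)
  norm_num [Nat.choose]
  field_simp
  ring

lemma powerGeometric_5 {ζ : ℂ} (hζ : ‖ζ‖ < 1) :
    powerGeometric 5 ζ = (ζ * (1 + 26 * ζ + 66 * ζ ^ 2 + 26 * ζ ^ 3 + ζ ^ 4)) / (ζ - 1) ^ 6 := by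
  have h := sub_one_mul_powerGeometric hζ (m := 5) (by norm_num)
  have hz := sub_one_ne_zero_of_norm_lt_one hζ
  simp only [Finset.sum_range_succ, Finset.sum_range_zero, powerGeometric_zero hζ,
    powerGeometric_1 hζ, powerGeometric_2 hζ, powerGeometric_3 hζ, powerGeometric_4 hζ] at h
  refine mul_left_cancel₀ hz (h.trans ?_)
  norm_num [Nat.choose]
  field_simp
  ring

lemma powerGeometric_6 {ζ : ℂ} (hζ : ‖ζ‖ < 1) :
    powerGeometric 6 ζ = -(ζ * (1 + 57 * ζ + 302 * ζ ^ 2 + 302 * ζ ^ 3 + 57 * ζ ^ 4 +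
      ζ ^ 5)) / (ζ - 1) ^ 7 := by
  have h := sub_one_mul_powerGeometric hζ (m := 6) (by norm_num)
  have hz := sub_one_ne_zero_of_norm_lt_one hζ
  simp only [Finset.sum_range_succ, Finset.sum_range_zero, powerGeometric_zero hζ,
    powerGeometric_1 hζ, powerGeometric_2 hζ, powerGeometric_3 hζ, powerGeometric_4 hζ,
    powerGeometric_5 hζ] at h
  refine mul_left_cancel₀ hz (h.trans ?_)
  norm_num [Nat.choose]
  field_simp
  ring

lemma powerGeometric_7 {ζ : ℂ} (hζ : ‖ζ‖ < 1) :
    powerGeometric 7 ζ = (ζ * (1 + 120 * ζ + 1191 * ζ ^ 2 + 2416 * ζ ^ 3 + 1191 * ζ ^ 4 +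
      120 * ζ ^ 5 + ζ ^ 6)) / (ζ - 1) ^ 8 := by
  have h := sub_one_mul_powerGeometric hζ (m := 7) (by norm_num)
  have hz := sub_one_ne_zero_of_norm_lt_one hζ
  simp only [Finset.sum_range_succ, Finset.sum_range_zero, powerGeometric_zero hζ,
    powerGeometric_1 hζ, powerGeometric_2 hζ, powerGeometric_3 hζ, powerGeometric_4 hζ,
    powerGeometric_5 hζ, powerGeometric_6 hζ] at h
  refine mul_left_cancel₀ hz (h.trans ?_)
  norm_num [Nat.choose]
  field_simp
  ring

lemma powerGeometric_8 {ζ : ℂ} (hζ : ‖ζ‖ < 1) :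
    powerGeometric 8 ζ = -(ζ * (1 + 247 * ζ + 4293 * ζ ^ 2 + 15619 * ζ ^ 3 + 15619 * ζ ^ 4 +
      4293 * ζ ^ 5 + 247 * ζ ^ 6 + ζ ^ 7)) / (ζ - 1) ^ 9 := by
  have h := sub_one_mul_powerGeometric hζ (m := 8) (by norm_num)
  have hz := sub_one_ne_zero_of_norm_lt_one hζ
  simp only [Finset.sum_range_succ, Finset.sum_range_zero, powerGeometric_zero hζ,
    powerGeometric_1 hζ, powerGeometric_2 hζ, powerGeometric_3 hζ, powerGeometric_4 hζ,
    powerGeometric_5 hζ, powerGeometric_6 hζ, powerGeometric_7 hζ] at h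
  refine mul_left_cancel₀ hz (h.trans ?_)
  norm_num [Nat.choose]
  field_simp
  ring

lemma powerGeometric_9 {ζ : ℂ} (hζ : ‖ζ‖ < 1) :
    powerGeometric 9 ζ = (ζ * (1 + 502 * ζ + 14608 * ζ ^ 2 + 88234 * ζ ^ 3 + 156190 * ζ ^ 4 +
      88234 * ζ ^ 5 + 14608 * ζ ^ 6 + 502 * ζ ^ 7 + ζ ^ 8)) / (ζ - 1) ^ 10 := by
  have h := sub_one_mul_powerGeometric hζ (m := 9) (by norm_num)
  have hz := sub_one_ne_zero_of_norm_lt_one hζ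
  simp only [Finset.sum_range_succ, Finset.sum_range_zero, powerGeometric_zero hζ,
    powerGeometric_1 hζ, powerGeometric_2 hζ, powerGeometric_3 hζ, powerGeometric_4 hζ,
    powerGeometric_5 hζ, powerGeometric_6 hζ, powerGeometric_7 hζ, powerGeometric_8 hζ] at h
  refine mul_left_cancel₀ hz (h.trans ?_)
  norm_num [Nat.choose]
  field_simp
  ring

lemma powerGeometric_10 {ζ : ℂ} (hζ : ‖ζ‖ < 1) :
    powerGeometric 10 ζ = -(ζ * (1 + 1013 * ζ + 47840 * ζ ^ 2 + 455192 * ζ ^ 3 +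
      1310354 * ζ ^ 4 + 1310354 * ζ ^ 5 + 455192 * ζ ^ 6 + 47840 * ζ ^ 7 + 1013 * ζ ^ 8 +
      ζ ^ 9)) / (ζ - 1) ^ 11 := by
  have h := sub_one_mul_powerGeometric hζ (m := 10) (by norm_num)
  have hz := sub_one_ne_zero_of_norm_lt_one hζ
  simp only [Finset.sum_range_succ, Finset.sum_range_zero, powerGeometric_zero hζ,
    powerGeometric_1 hζ, powerGeometric_2 hζ, powerGeometric_3 hζ, powerGeometric_4 hζ,
    powerGeometric_5 hζ, powerGeometric_6 hζ, powerGeometric_7 hζ, powerGeometric_8 hζ,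
    powerGeometric_9 hζ] at h
  refine mul_left_cancel₀ hz (h.trans ?_)
  norm_num [Nat.choose]
  field_simp
  ring

/-- In general `oddPowerSum m` is a polynomial in `k` of degree `m + 1` and of that parity, with
leading coefficient 2^m/(m+1). Its generating function, weighted by `k`, yields the polynomial
p_{m+1} of the expansion. -/
lemma oddPowerSum_0 (k : ℕ) : oddPowerSum 0 k =
    (1) * (k : ℂ) ^ 1 := by
  induction k with
  | zero => norm_num [oddPowerSum]
  | succ k ih =>
    rw [oddPowerSum_succ, ih]
    push_cast
    ring

lemma hasSum_oddPowerSum_0 {ζ : ℂ} (hζ : ‖ζ‖ < 1) :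
    HasSum (fun k : ℕ => k * oddPowerSum 0 k * ζ ^ k)
      (-(ζ * (1 + ζ)) / (ζ - 1) ^ 3) := by
  have hz := sub_one_ne_zero_of_norm_lt_one hζ
  have h := ((hasSum_powerGeometric hζ 2).mul_left (1))
  have hv : (1) * powerGeometric 2 ζ
      = -(ζ * (1 + ζ)) / (ζ - 1) ^ 3 := by
    rw [powerGeometric_2 hζ]
    field_simp
  rw [hv] at h
  refine h.congr_fun fun k => ?_
  rw [oddPowerSum_0]
  ring

lemma oddPowerSum_1 (k : ℕ) : oddPowerSum 1 k =
    (1) * (k : ℂ) ^ 2 := by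
  induction k with
  | zero => norm_num [oddPowerSum]
  | succ k ih =>
    rw [oddPowerSum_succ, ih]
    push_cast
    ring

lemma hasSum_oddPowerSum_1 {ζ : ℂ} (hζ : ‖ζ‖ < 1) :
    HasSum (fun k : ℕ => k * oddPowerSum 1 k * ζ ^ k)
      ((ζ * (1 + 4 * ζ + ζ ^ 2)) / (ζ - 1) ^ 4) := by
  have hz := sub_one_ne_zero_of_norm_lt_one hζ
  have h := ((hasSum_powerGeometric hζ 3).mul_left (1))
  have hv : (1) * powerGeometric 3 ζ
      = (ζ * (1 + 4 * ζ + ζ ^ 2)) / (ζ - 1) ^ 4 := by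
    rw [powerGeometric_3 hζ]
    field_simp
  rw [hv] at h
  refine h.congr_fun fun k => ?_
  rw [oddPowerSum_1]
  ring

lemma oddPowerSum_2 (k : ℕ) : oddPowerSum 2 k =
    (-1 / 3) * (k : ℂ) ^ 1 + (4 / 3) * (k : ℂ) ^ 3 := by
  induction k with
  | zero => norm_num [oddPowerSum]
  | succ k ih =>
    rw [oddPowerSum_succ, ih]
    push_cast
    ring

lemma hasSum_oddPowerSum_2 {ζ : ℂ} (hζ : ‖ζ‖ < 1) :
    HasSum (fun k : ℕ => k * oddPowerSum 2 k * ζ ^ k)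
      (-(ζ * (1 + 15 * ζ + 15 * ζ ^ 2 + ζ ^ 3)) / (ζ - 1) ^ 5) := by
  have hz := sub_one_ne_zero_of_norm_lt_one hζ
  have h := (((hasSum_powerGeometric hζ 2).mul_left (-1 / 3)).add
    ((hasSum_powerGeometric hζ 4).mul_left (4 / 3)))
  have hv : (-1 / 3) * powerGeometric 2 ζ + (4 / 3) * powerGeometric 4 ζ
      = -(ζ * (1 + 15 * ζ + 15 * ζ ^ 2 + ζ ^ 3)) / (ζ - 1) ^ 5 := by
    rw [powerGeometric_2 hζ, powerGeometric_4 hζ]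
    field_simp
    ring
  rw [hv] at h
  refine h.congr_fun fun k => ?_
  rw [oddPowerSum_2]
  ring

lemma oddPowerSum_3 (k : ℕ) : oddPowerSum 3 k =
    (-1) * (k : ℂ) ^ 2 + (2) * (k : ℂ) ^ 4 := by
  induction k with
  | zero => norm_num [oddPowerSum]
  | succ k ih =>
    rw [oddPowerSum_succ, ih]
    push_cast
    ring

lemma hasSum_oddPowerSum_3 {ζ : ℂ} (hζ : ‖ζ‖ < 1) :
    HasSum (fun k : ℕ => k * oddPowerSum 3 k * ζ ^ k)
      ((ζ * (1 + 50 * ζ + 138 * ζ ^ 2 + 50 * ζ ^ 3 + ζ ^ 4)) / (ζ - 1) ^ 6) := by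
  have hz := sub_one_ne_zero_of_norm_lt_one hζ
  have h := (((hasSum_powerGeometric hζ 3).mul_left (-1)).add
    ((hasSum_powerGeometric hζ 5).mul_left (2)))
  have hv : (-1) * powerGeometric 3 ζ + (2) * powerGeometric 5 ζ
      = (ζ * (1 + 50 * ζ + 138 * ζ ^ 2 + 50 * ζ ^ 3 + ζ ^ 4)) / (ζ - 1) ^ 6 := by
    rw [powerGeometric_3 hζ, powerGeometric_5 hζ]
    field_simp
    ring
  rw [hv] at h
  refine h.congr_fun fun k => ?_
  rw [oddPowerSum_3]
  ring

lemma oddPowerSum_4 (k : ℕ) : oddPowerSum 4 k =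
    (7 / 15) * (k : ℂ) ^ 1 + (-8 / 3) * (k : ℂ) ^ 3 + (16 / 5) * (k : ℂ) ^ 5 := by
  induction k with
  | zero => norm_num [oddPowerSum]
  | succ k ih =>
    rw [oddPowerSum_succ, ih]
    push_cast
    ring

lemma hasSum_oddPowerSum_4 {ζ : ℂ} (hζ : ‖ζ‖ < 1) :
    HasSum (fun k : ℕ => k * oddPowerSum 4 k * ζ ^ k)
      (-(ζ * (1 + 157 * ζ + 994 * ζ ^ 2 + 994 * ζ ^ 3 + 157 * ζ ^ 4 + ζ ^ 5)) / (ζ - 1) ^ 7) := by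
  have hz := sub_one_ne_zero_of_norm_lt_one hζ
  have h := ((((hasSum_powerGeometric hζ 2).mul_left (7 / 15)).add
    ((hasSum_powerGeometric hζ 4).mul_left (-8 / 3))).add
    ((hasSum_powerGeometric hζ 6).mul_left (16 / 5)))
  have hv : (7 / 15) * powerGeometric 2 ζ + (-8 / 3) * powerGeometric 4 ζ +
    (16 / 5) * powerGeometric 6 ζ
      = -(ζ * (1 + 157 * ζ + 994 * ζ ^ 2 + 994 * ζ ^ 3 + 157 * ζ ^ 4 + ζ ^ 5)) / (ζ - 1) ^ 7 := by
    rw [powerGeometric_2 hζ, powerGeometric_4 hζ, powerGeometric_6 hζ]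
    field_simp
    ring
  rw [hv] at h
  refine h.congr_fun fun k => ?_
  rw [oddPowerSum_4]
  ring

lemma oddPowerSum_5 (k : ℕ) : oddPowerSum 5 k =
    (7 / 3) * (k : ℂ) ^ 2 + (-20 / 3) * (k : ℂ) ^ 4 + (16 / 3) * (k : ℂ) ^ 6 := by
  induction k with
  | zero => norm_num [oddPowerSum]
  | succ k ih =>
    rw [oddPowerSum_succ, ih]
    push_cast
    ring

lemma hasSum_oddPowerSum_5 {ζ : ℂ} (hζ : ‖ζ‖ < 1) :
    HasSum (fun k : ℕ => k * oddPowerSum 5 k * ζ ^ k)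
      ((ζ * (1 + 480 * ζ + 6231 * ζ ^ 2 + 13456 * ζ ^ 3 + 6231 * ζ ^ 4 + 480 * ζ ^ 5 +
        ζ ^ 6)) / (ζ - 1) ^ 8) := by
  have hz := sub_one_ne_zero_of_norm_lt_one hζ
  have h := ((((hasSum_powerGeometric hζ 3).mul_left (7 / 3)).add
    ((hasSum_powerGeometric hζ 5).mul_left (-20 / 3))).add
    ((hasSum_powerGeometric hζ 7).mul_left (16 / 3)))
  have hv : (7 / 3) * powerGeometric 3 ζ + (-20 / 3) * powerGeometric 5 ζ +
    (16 / 3) * powerGeometric 7 ζ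
      = (ζ * (1 + 480 * ζ + 6231 * ζ ^ 2 + 13456 * ζ ^ 3 + 6231 * ζ ^ 4 + 480 * ζ ^ 5 +
        ζ ^ 6)) / (ζ - 1) ^ 8 := by
    rw [powerGeometric_3 hζ, powerGeometric_5 hζ, powerGeometric_7 hζ]
    field_simp
    ring
  rw [hv] at h
  refine h.congr_fun fun k => ?_
  rw [oddPowerSum_5]
  ring

lemma oddPowerSum_6 (k : ℕ) : oddPowerSum 6 k =
    (-31 / 21) * (k : ℂ) ^ 1 + (28 / 3) * (k : ℂ) ^ 3 + (-16) * (k : ℂ) ^ 5 +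
      (64 / 7) * (k : ℂ) ^ 7 := by
  induction k with
  | zero => norm_num [oddPowerSum]
  | succ k ih =>
    rw [oddPowerSum_succ, ih]
    push_cast
    ring

lemma hasSum_oddPowerSum_6 {ζ : ℂ} (hζ : ‖ζ‖ < 1) :
    HasSum (fun k : ℕ => k * oddPowerSum 6 k * ζ ^ k)
      (-(ζ * (1 + 1451 * ζ + 35961 * ζ ^ 2 + 146907 * ζ ^ 3 + 146907 * ζ ^ 4 + 35961 * ζ ^ 5 +
        1451 * ζ ^ 6 + ζ ^ 7)) / (ζ - 1) ^ 9) := by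
  have hz := sub_one_ne_zero_of_norm_lt_one hζ
  have h := (((((hasSum_powerGeometric hζ 2).mul_left (-31 / 21)).add
    ((hasSum_powerGeometric hζ 4).mul_left (28 / 3))).add
    ((hasSum_powerGeometric hζ 6).mul_left (-16))).add
    ((hasSum_powerGeometric hζ 8).mul_left (64 / 7)))
  have hv : (-31 / 21) * powerGeometric 2 ζ + (28 / 3) * powerGeometric 4 ζ +
    (-16) * powerGeometric 6 ζ + (64 / 7) * powerGeometric 8 ζ
      = -(ζ * (1 + 1451 * ζ + 35961 * ζ ^ 2 + 146907 * ζ ^ 3 + 146907 * ζ ^ 4 + 35961 * ζ ^ 5 +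
        1451 * ζ ^ 6 + ζ ^ 7)) / (ζ - 1) ^ 9 := by
    rw [powerGeometric_2 hζ, powerGeometric_4 hζ, powerGeometric_6 hζ, powerGeometric_8 hζ]
    field_simp
    ring
  rw [hv] at h
  refine h.congr_fun fun k => ?_
  rw [oddPowerSum_6]
  ring

lemma oddPowerSum_7 (k : ℕ) : oddPowerSum 7 k =
    (-31 / 3) * (k : ℂ) ^ 2 + (98 / 3) * (k : ℂ) ^ 4 + (-112 / 3) * (k : ℂ) ^ 6 +
      (16) * (k : ℂ) ^ 8 := by
  induction k with
  | zero => norm_num [oddPowerSum]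
  | succ k ih =>
    rw [oddPowerSum_succ, ih]
    push_cast
    ring

lemma hasSum_oddPowerSum_7 {ζ : ℂ} (hζ : ‖ζ‖ < 1) :
    HasSum (fun k : ℕ => k * oddPowerSum 7 k * ζ ^ k)
      ((ζ * (1 + 4366 * ζ + 197224 * ζ ^ 2 + 1402834 * ζ ^ 3 + 2597230 * ζ ^ 4 +
        1402834 * ζ ^ 5 + 197224 * ζ ^ 6 + 4366 * ζ ^ 7 + ζ ^ 8)) / (ζ - 1) ^ 10) := by
  have hz := sub_one_ne_zero_of_norm_lt_one hζ
  have h := (((((hasSum_powerGeometric hζ 3).mul_left (-31 / 3)).add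
    ((hasSum_powerGeometric hζ 5).mul_left (98 / 3))).add
    ((hasSum_powerGeometric hζ 7).mul_left (-112 / 3))).add
    ((hasSum_powerGeometric hζ 9).mul_left (16)))
  have hv : (-31 / 3) * powerGeometric 3 ζ + (98 / 3) * powerGeometric 5 ζ +
    (-112 / 3) * powerGeometric 7 ζ + (16) * powerGeometric 9 ζ
      = (ζ * (1 + 4366 * ζ + 197224 * ζ ^ 2 + 1402834 * ζ ^ 3 + 2597230 * ζ ^ 4 +
        1402834 * ζ ^ 5 + 197224 * ζ ^ 6 + 4366 * ζ ^ 7 + ζ ^ 8)) / (ζ - 1) ^ 10 := by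
    rw [powerGeometric_3 hζ, powerGeometric_5 hζ, powerGeometric_7 hζ, powerGeometric_9 hζ]
    field_simp
    ring
  rw [hv] at h
  refine h.congr_fun fun k => ?_
  rw [oddPowerSum_7]
  ring

lemma oddPowerSum_8 (k : ℕ) : oddPowerSum 8 k =
    (127 / 15) * (k : ℂ) ^ 1 + (-496 / 9) * (k : ℂ) ^ 3 + (1568 / 15) * (k : ℂ) ^ 5 +
      (-256 / 3) * (k : ℂ) ^ 7 + (256 / 9) * (k : ℂ) ^ 9 := by
  induction k with
  | zero => norm_num [oddPowerSum]
  | succ k ih =>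
    rw [oddPowerSum_succ, ih]
    push_cast
    ring

lemma hasSum_oddPowerSum_8 {ζ : ℂ} (hζ : ‖ζ‖ < 1) :
    HasSum (fun k : ℕ => k * oddPowerSum 8 k * ζ ^ k)
      (-(ζ * (1 + 13113 * ζ + 1047252 * ζ ^ 2 + 12262436 * ζ ^ 3 + 38286798 * ζ ^ 4 +
        38286798 * ζ ^ 5 + 12262436 * ζ ^ 6 + 1047252 * ζ ^ 7 + 13113 * ζ ^ 8 +
        ζ ^ 9)) / (ζ - 1) ^ 11) := by
  have hz := sub_one_ne_zero_of_norm_lt_one hζ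
  have h := ((((((hasSum_powerGeometric hζ 2).mul_left (127 / 15)).add
    ((hasSum_powerGeometric hζ 4).mul_left (-496 / 9))).add
    ((hasSum_powerGeometric hζ 6).mul_left (1568 / 15))).add
    ((hasSum_powerGeometric hζ 8).mul_left (-256 / 3))).add
    ((hasSum_powerGeometric hζ 10).mul_left (256 / 9)))
  have hv : (127 / 15) * powerGeometric 2 ζ + (-496 / 9) * powerGeometric 4 ζ +
    (1568 / 15) * powerGeometric 6 ζ + (-256 / 3) * powerGeometric 8 ζ +
    (256 / 9) * powerGeometric 10 ζ
      = -(ζ * (1 + 13113 * ζ + 1047252 * ζ ^ 2 + 12262436 * ζ ^ 3 + 38286798 * ζ ^ 4 +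
        38286798 * ζ ^ 5 + 12262436 * ζ ^ 6 + 1047252 * ζ ^ 7 + 13113 * ζ ^ 8 +
        ζ ^ 9)) / (ζ - 1) ^ 11 := by
    rw [powerGeometric_2 hζ, powerGeometric_4 hζ, powerGeometric_6 hζ, powerGeometric_8 hζ,
      powerGeometric_10 hζ]
    field_simp
    ring
  rw [hv] at h
  refine h.congr_fun fun k => ?_
  rw [oddPowerSum_8]
  ring

end PowerSeries

/-! ### The expansion in 1/N and its uniform error. -/

section GlobalExpansion

open Finset

/-- The expansion of the structure factor in powers of `1 / N` through order `N ^ (-9)`. -/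
def expansionCoeff (N k : ℕ) : ℂ :=
  (k : ℂ) / 2 * (1 + ∑ m ∈ range 9, oddPowerSum m k / (2 * (N : ℂ)) ^ (m + 1))

/-- The generating function of the expansion coefficients. -/
lemma hasSum_expansionCoeff {N : ℕ} (hN : 1 ≤ N) {ζ : ℂ} (hζ : ‖ζ‖ < 1) :
    HasSum (fun k : ℕ => -4 * (expansionCoeff N k * ζ ^ k)) (cseGlobalExpansion N ζ) := by
  have hz := sub_one_ne_zero_of_norm_lt_one hζ
  have hN0 : (N : ℂ) ≠ 0 := by exact_mod_cast (by omega : N ≠ 0)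
  have t0 : HasSum (fun k : ℕ => -2 * ((k : ℂ) ^ 1 * ζ ^ k)) (-(2 * ζ) / (ζ - 1) ^ 2) := by
    refine Eq.subst (motive := HasSum _) ?_ ((hasSum_powerGeometric hζ 1).mul_left (-2))
    rw [powerGeometric_1 hζ]
    ring
  -- Order `m + 1` in 1/N collects `oddPowerSum m` with the factor -4 · 1/2 = -2. Even orders are
  -- stated with +2 and subtracted below, to match the signs of `cseGlobalExpansion`.
  have t1 : HasSum (fun k : ℕ => -2 / (2 * (N : ℂ)) ^ 1 * (k * oddPowerSum 0 k * ζ ^ k))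
      (1 / (N * (ζ - 1) ^ 3) * ζ *
        (1 + ζ)) := by
    refine Eq.subst (motive := HasSum _) ?_ ((hasSum_oddPowerSum_0 hζ).mul_left _)
    field_simp
  have t2 : HasSum (fun k : ℕ => 2 / (2 * (N : ℂ)) ^ 2 * (k * oddPowerSum 1 k * ζ ^ k))
      (1 / (2 * N ^ 2 * (ζ - 1) ^ 4) * ζ *
        (1 + 4 * ζ + ζ ^ 2)) := by
    refine Eq.subst (motive := HasSum _) ?_ ((hasSum_oddPowerSum_1 hζ).mul_left _)
    field_simp
  have t3 : HasSum (fun k : ℕ => -2 / (2 * (N : ℂ)) ^ 3 * (k * oddPowerSum 2 k * ζ ^ k))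
      (1 / (4 * N ^ 3 * (ζ - 1) ^ 5) * ζ *
        (1 + 15 * ζ + 15 * ζ ^ 2 + ζ ^ 3)) := by
    refine Eq.subst (motive := HasSum _) ?_ ((hasSum_oddPowerSum_2 hζ).mul_left _)
    field_simp
    ring
  have t4 : HasSum (fun k : ℕ => 2 / (2 * (N : ℂ)) ^ 4 * (k * oddPowerSum 3 k * ζ ^ k))
      (1 / (8 * N ^ 4 * (ζ - 1) ^ 6) * ζ *
        (1 + 50 * ζ + 138 * ζ ^ 2 + 50 * ζ ^ 3 + ζ ^ 4)) := by
    refine Eq.subst (motive := HasSum _) ?_ ((hasSum_oddPowerSum_3 hζ).mul_left _)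
    field_simp
    ring
  have t5 : HasSum (fun k : ℕ => -2 / (2 * (N : ℂ)) ^ 5 * (k * oddPowerSum 4 k * ζ ^ k))
      (1 / (16 * N ^ 5 * (ζ - 1) ^ 7) * ζ *
        (1 + 157 * ζ + 994 * ζ ^ 2 + 994 * ζ ^ 3 + 157 * ζ ^ 4 + ζ ^ 5)) := by
    refine Eq.subst (motive := HasSum _) ?_ ((hasSum_oddPowerSum_4 hζ).mul_left _)
    field_simp
    ring
  have t6 : HasSum (fun k : ℕ => 2 / (2 * (N : ℂ)) ^ 6 * (k * oddPowerSum 5 k * ζ ^ k))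
      (1 / (32 * N ^ 6 * (ζ - 1) ^ 8) * ζ *
        (1 + 480 * ζ + 6231 * ζ ^ 2 + 13456 * ζ ^ 3 + 6231 * ζ ^ 4 + 480 * ζ ^ 5 + ζ ^ 6)) := by
    refine Eq.subst (motive := HasSum _) ?_ ((hasSum_oddPowerSum_5 hζ).mul_left _)
    field_simp
    ring
  have t7 : HasSum (fun k : ℕ => -2 / (2 * (N : ℂ)) ^ 7 * (k * oddPowerSum 6 k * ζ ^ k))
      (1 / (64 * N ^ 7 * (ζ - 1) ^ 9) * ζ *
        (1 + 1451 * ζ + 35961 * ζ ^ 2 + 146907 * ζ ^ 3 + 146907 * ζ ^ 4 + 35961 * ζ ^ 5 +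
          1451 * ζ ^ 6 + ζ ^ 7)) := by
    refine Eq.subst (motive := HasSum _) ?_ ((hasSum_oddPowerSum_6 hζ).mul_left _)
    field_simp
    ring
  have t8 : HasSum (fun k : ℕ => 2 / (2 * (N : ℂ)) ^ 8 * (k * oddPowerSum 7 k * ζ ^ k))
      (1 / (128 * N ^ 8 * (ζ - 1) ^ 10) * ζ *
        (1 + 4366 * ζ + 197224 * ζ ^ 2 + 1402834 * ζ ^ 3 + 2597230 * ζ ^ 4 + 1402834 * ζ ^ 5 +
          197224 * ζ ^ 6 + 4366 * ζ ^ 7 + ζ ^ 8)) := by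
    refine Eq.subst (motive := HasSum _) ?_ ((hasSum_oddPowerSum_7 hζ).mul_left _)
    field_simp
    ring
  have t9 : HasSum (fun k : ℕ => -2 / (2 * (N : ℂ)) ^ 9 * (k * oddPowerSum 8 k * ζ ^ k))
      (1 / (256 * N ^ 9 * (ζ - 1) ^ 11) * ζ *
        (1 + 13113 * ζ + 1047252 * ζ ^ 2 + 12262436 * ζ ^ 3 + 38286798 * ζ ^ 4 +
          38286798 * ζ ^ 5 + 12262436 * ζ ^ 6 + 1047252 * ζ ^ 7 + 13113 * ζ ^ 8 + ζ ^ 9)) := by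
    refine Eq.subst (motive := HasSum _) ?_ ((hasSum_oddPowerSum_8 hζ).mul_left _)
    field_simp
    ring
  have h := ((((((((t0.add t1).sub t2).add t3).sub t4).add t5).sub t6).add t7).sub t8).add t9
  refine HasSum.congr_fun h fun k => ?_
  simp only [expansionCoeff, sum_range_succ, sum_range_zero]
  ring

/-- The finite geometric series in y = (2e+1)/(2N) with its exact remainder. It holds also for y >
1, where the infinite series diverges, because parity excludes y = 1. -/
lemma odd_inv_eq {N : ℕ} (hN : 1 ≤ N) (e : ℕ) :
    (2 * (N : ℂ) - 1 - 2 * e)⁻¹ = ∑ m ∈ range 9, (2 * (e : ℂ) + 1) ^ m / (2 * (N : ℂ)) ^ (m + 1)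
      + ((2 * (e : ℂ) + 1) / (2 * N)) ^ 9 * (2 * (N : ℂ) - 1 - 2 * e)⁻¹ := by
  have hN0 : (N : ℂ) ≠ 0 := by exact_mod_cast (by omega : N ≠ 0)
  have h1 := two_mul_sub_odd_ne_zero N e
  have h2 := geom_sum_mul ((2 * (e : ℂ) + 1) / (2 * N)) 9
  have h3 : ∑ m ∈ range 9, (2 * (e : ℂ) + 1) ^ m / (2 * (N : ℂ)) ^ (m + 1)
      = (∑ m ∈ range 9, ((2 * (e : ℂ) + 1) / (2 * N)) ^ m) / (2 * N) := by
    rw [sum_div]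
    refine sum_congr rfl fun m _ => ?_
    rw [div_pow, div_div, pow_succ]
  rw [h3]
  generalize ∑ m ∈ range 9, ((2 * (e : ℂ) + 1) / (2 * N)) ^ m = S at h2
  have h4 : (2 * (e : ℂ) + 1) / (2 * N) - 1 = -(2 * (N : ℂ) - 1 - 2 * e) / (2 * N) := by
    field_simp
    ring
  rw [h4] at h2
  generalize ((2 * (e : ℂ) + 1) / (2 * N)) ^ 9 = y at h2
  have h5 : y = 1 - S * (2 * (N : ℂ) - 1 - 2 * e) / (2 * N) := by linear_combination -h2
  rw [h5]
  field_simp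
  ring

/-- The remainder in `odd_inv_eq` has nine powers of 1/N; this bound supplies the tenth, at the cost
of a factor `e + 1`. With `a` the absolute value of the denominator, `a ≥ 1` and `a ≥ 2N - 1 - 2e`
give N ≤ e + a ≤ (e+1)a. -/
lemma norm_odd_inv_le {N : ℕ} (hN : 1 ≤ N) (e : ℕ) :
    ‖(2 * (N : ℂ) - 1 - 2 * e)⁻¹‖ ≤ (e + 1) / N := by
  have hN0 : (0 : ℝ) < N := by exact_mod_cast hN
  have h : (2 * (N : ℂ) - 1 - 2 * e) = ((2 * (N : ℤ) - 1 - 2 * e : ℤ) : ℂ) := by push_cast; ring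
  have h1 : (1 : ℝ) ≤ |((2 * (N : ℤ) - 1 - 2 * e : ℤ) : ℝ)| := by
    exact_mod_cast Int.one_le_abs (by omega : 2 * (N : ℤ) - 1 - 2 * e ≠ 0)
  have h2 := le_abs_self ((2 * (N : ℤ) - 1 - 2 * e : ℤ) : ℝ)
  rw [norm_inv, h, Complex.norm_intCast]
  set a : ℝ := |((2 * (N : ℤ) - 1 - 2 * e : ℤ) : ℝ)|
  push_cast at h2
  have he : (0 : ℝ) ≤ e := Nat.cast_nonneg e
  rw [inv_le_comm₀ (by linarith) (by positivity), inv_div, div_le_iff₀ (by positivity)]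
  nlinarith

lemma norm_oddHarmonic_le (N k : ℕ) : ‖oddHarmonic N k‖ ≤ k := by
  unfold oddHarmonic
  refine (norm_sum_le_of_le _ fun e _ => norm_two_mul_sub_odd_inv_le N e).trans ?_
  simp

lemma norm_half_mul_sub_expansionCoeff_le {N : ℕ} (hN : 1 ≤ N) (k : ℕ) :
    ‖(k : ℂ) / 2 * (1 + oddHarmonic N k) - expansionCoeff N k‖ ≤ (k : ℝ) ^ 12 / N ^ 10 := by
  have hN0 : (0 : ℝ) < N := by exact_mod_cast hN
  have h1 : (k : ℂ) / 2 * (1 + oddHarmonic N k) - expansionCoeff N k = (k : ℂ) / 2 *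
      ∑ e ∈ range k, ((2 * (e : ℂ) + 1) / (2 * N)) ^ 9 * (2 * (N : ℂ) - 1 - 2 * e)⁻¹ := by
    have h2 : oddHarmonic N k = ∑ m ∈ range 9, oddPowerSum m k / (2 * (N : ℂ)) ^ (m + 1)
        + ∑ e ∈ range k, ((2 * (e : ℂ) + 1) / (2 * N)) ^ 9 * (2 * (N : ℂ) - 1 - 2 * e)⁻¹ := by
      unfold oddHarmonic oddPowerSum
      rw [sum_congr rfl fun e _ => odd_inv_eq hN e, sum_add_distrib, sum_comm]
      simp only [sum_div]
    rw [h2, expansionCoeff]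
    ring
  have h3 : ∀ e ∈ range k, ‖((2 * (e : ℂ) + 1) / (2 * N)) ^ 9 * (2 * (N : ℂ) - 1 - 2 * e)⁻¹‖
      ≤ ((k : ℝ) / N) ^ 10 := by
    intro e he
    have hek : (e : ℝ) + 1 ≤ k := by exact_mod_cast mem_range.1 he
    have h4 : ‖(2 * (e : ℂ) + 1) / (2 * N)‖ ≤ (k : ℝ) / N := by
      have h5 : (2 * (e : ℂ) + 1) / (2 * N) = (((2 * (e : ℝ) + 1) / (2 * N) : ℝ) : ℂ) := by
        push_cast; ring
      rw [h5, Complex.norm_real, Real.norm_of_nonneg (by positivity),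
        div_le_div_iff₀ (by positivity) hN0]
      nlinarith
    have h6 : ‖(2 * (N : ℂ) - 1 - 2 * e)⁻¹‖ ≤ (k : ℝ) / N :=
      (norm_odd_inv_le hN e).trans (by gcongr)
    rw [norm_mul, norm_pow, pow_succ _ 9]
    gcongr
  rw [h1, norm_mul]
  have h7 : ‖(k : ℂ) / 2‖ ≤ k := by
    rw [norm_div, Complex.norm_natCast]
    norm_num
  calc ‖(k : ℂ) / 2‖ * ‖∑ e ∈ range k, ((2 * (e : ℂ) + 1) / (2 * N)) ^ 9 *
          (2 * (N : ℂ) - 1 - 2 * e)⁻¹‖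
      ≤ k * (k * ((k : ℝ) / N) ^ 10) := by
        refine mul_le_mul h7 ((norm_sum_le_of_le _ h3).trans ?_) (norm_nonneg _) (by positivity)
        simp
    _ = (k : ℝ) ^ 12 / N ^ 10 := by rw [div_pow]; ring

/-- The error of the expansion of the structure factor. -/
lemma norm_structureFactor_sub_expansionCoeff_le {N : ℕ} (hN : 1 ≤ N) (k : ℕ) :
    ‖structureFactor N k - expansionCoeff N k‖ ≤ 3 * (k : ℝ) ^ 12 / N ^ 10 := by
  have hN0 : (0 : ℝ) < N := by exact_mod_cast hN
  have h1 := norm_half_mul_sub_expansionCoeff_le hN k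
  have h0 : 0 ≤ (k : ℝ) ^ 12 / (N : ℝ) ^ 10 := by positivity
  have h3 : 3 * (k : ℝ) ^ 12 / (N : ℝ) ^ 10
      = 2 * ((k : ℝ) ^ 12 / (N : ℝ) ^ 10) + (k : ℝ) ^ 12 / (N : ℝ) ^ 10 := by ring
  rw [h3]
  unfold structureFactor
  split_ifs with hk
  · linarith
  -- Beyond `2 * N` the true value `N` differs from the formula by at most 2k², and k/N ≥ 1 allows
  -- inserting the factor (k/N)¹⁰.
  · have hkN : (N : ℝ) ≤ k := by exact_mod_cast (by omega : N ≤ k)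
    have hk1 : (1 : ℝ) ≤ k := by exact_mod_cast (by omega : 1 ≤ k)
    have h4 : (1 : ℝ) ≤ ((k : ℝ) / N) ^ 10 := one_le_pow₀ ((one_le_div hN0).2 hkN)
    have h5 : ‖(N : ℂ) - (k : ℂ) / 2 * (1 + oddHarmonic N k)‖ ≤ 2 * (k : ℝ) ^ 2 := by
      have h6 : ‖1 + oddHarmonic N k‖ ≤ 1 + k :=
        (norm_add_le _ _).trans (by rw [norm_one]; gcongr; exact norm_oddHarmonic_le N k)
      calc ‖(N : ℂ) - (k : ℂ) / 2 * (1 + oddHarmonic N k)‖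
          ≤ ‖(N : ℂ)‖ + ‖(k : ℂ) / 2 * (1 + oddHarmonic N k)‖ := norm_sub_le _ _
        _ ≤ N + k / 2 * (1 + k) := by
            rw [norm_mul, norm_div, Complex.norm_natCast, Complex.norm_natCast]
            norm_num
            gcongr
        _ ≤ 2 * (k : ℝ) ^ 2 := by nlinarith
    have h7 : 2 * (k : ℝ) ^ 2 ≤ 2 * ((k : ℝ) ^ 12 / (N : ℝ) ^ 10) := by
      have h8 : (k : ℝ) ^ 12 / (N : ℝ) ^ 10 = (k : ℝ) ^ 2 * ((k : ℝ) / N) ^ 10 := by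
        rw [div_pow]; ring
      rw [h8]
      have : 0 ≤ (k : ℝ) ^ 2 := by positivity
      nlinarith
    calc ‖(N : ℂ) - expansionCoeff N k‖
        = ‖((N : ℂ) - (k : ℂ) / 2 * (1 + oddHarmonic N k))
            + ((k : ℂ) / 2 * (1 + oddHarmonic N k) - expansionCoeff N k)‖ := by ring_nf
      _ ≤ _ := (norm_add_le _ _).trans (add_le_add (h5.trans h7) h1)

theorem exists_norm_W₂_sub_cseGlobalExpansion_le {r : ℝ} (hr0 : 0 ≤ r) (hr1 : r < 1) :
    ∃ C : ℝ, ∀ N : ℕ, 1 ≤ N → ∀ z₁ z₂ : ℂ, ‖z₁‖ < 1 → 1 < ‖z₂‖ → ‖z₁ / z₂‖ ≤ r →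
      ‖W₂ N 2 z₁ z₂ - cseGlobalExpansion N (z₁ / z₂)‖ ≤ C / (N : ℝ) ^ 10 := by
  have hs : Summable fun k : ℕ => (k : ℝ) ^ 12 * r ^ k :=
    summable_pow_mul_geometric_of_norm_lt_one 12 (by rwa [Real.norm_of_nonneg hr0])
  -- 12 is the factor 4 of the generating function times the 3 of the coefficient bound, valid for
  -- all `k`.
  refine ⟨12 * ∑' k : ℕ, (k : ℝ) ^ 12 * r ^ k, fun N hN z₁ z₂ hz₁ hz₂ hζ => ?_⟩
  have h := (hasSum_W₂ hN hz₁ hz₂).sub (hasSum_expansionCoeff hN (hζ.trans_lt hr1))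
  have hg := hs.hasSum.mul_left (12 / (N : ℝ) ^ 10)
  rw [← h.tsum_eq]
  refine (tsum_of_norm_bounded hg fun k => ?_).trans (le_of_eq (by ring))
  have h1 : -4 * (structureFactor N k * (z₁ / z₂) ^ k) - -4 * (expansionCoeff N k * (z₁ / z₂) ^ k)
      = -4 * (structureFactor N k - expansionCoeff N k) * (z₁ / z₂) ^ k := by ring
  rw [h1, norm_mul, norm_mul, norm_pow]
  calc ‖(-4 : ℂ)‖ * ‖structureFactor N k - expansionCoeff N k‖ * ‖z₁ / z₂‖ ^ k
      ≤ 4 * (3 * (k : ℝ) ^ 12 / N ^ 10) * r ^ k := by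
        gcongr
        · norm_num
        · exact norm_structureFactor_sub_expansionCoeff_le hN k
    _ = 12 / (N : ℝ) ^ 10 * ((k : ℝ) ^ 12 * r ^ k) := by ring

end GlobalExpansion

end CircularEnsemble

end

theorem proposition5p2 :
    -- the exact form in the `(0, ∞)` domain, with `κ = 2` (`β = 4`) and `ζ = z₁ / z₂`
    (∀ (N : ℕ), 1 ≤ N → ∀ (z₁ z₂ : ℂ), ‖z₁‖ < 1 → 1 < ‖z₂‖ →
      CircularEnsemble.W₂ N 2 z₁ z₂ = CircularEnsemble.cseClosedForm N (z₁ / z₂)) ∧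
    -- the global expansion, with an error of order `N ^ (-10)` uniformly on compact sets of `ζ`
    (∀ (r : ℝ), 0 ≤ r → r < 1 → ∃ C : ℝ, ∀ (N : ℕ), 1 ≤ N → ∀ (z₁ z₂ : ℂ),
      ‖z₁‖ < 1 → 1 < ‖z₂‖ → ‖z₁ / z₂‖ ≤ r →
      ‖CircularEnsemble.W₂ N 2 z₁ z₂ - CircularEnsemble.cseGlobalExpansion N (z₁ / z₂)‖
        ≤ C / (N : ℝ) ^ 10) :=
  ⟨fun _ hN _ _ hz₁ hz₂ => CircularEnsemble.W₂_eq_cseClosedForm hN hz₁ hz₂,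
    fun _ hr0 hr1 => CircularEnsemble.exists_norm_W₂_sub_cseGlobalExpansion_le hr0 hr1⟩
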